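/- **Proposition 3.2.** Let $N$ be a smooth $n$-dimensional manifold and $(N,F)$ a Finsler manifold: $F:TN\to[0,\infty)$ is smooth on the slit tangent bundle $TN^0=TN\setminus 0(N)$, vanishes exactly on the zero section $0(N)$, is positively homogeneous of degree one on the fibres, and in every chart $(x^a)$ of $N$, with induced coordinates $(x^a,y^a)$ on $TN$, the matrix $g_{bc}=\frac12\frac{\partial^2F^2}{\partial y^b\partial y^c}$ is positive definite on $TN^0$. Let $[g^{bc}]$ be its inverse and put (with summation over repeated indices) $$G^a=\tfrac14 g^{ab}\Big(\frac{\partial^2F^2}{\partial y^b\partial x^c}y^c-\frac{\partial F^2}{\partial x^b}\Big),\qquad G^a_b=\frac{\partial G^a}{\partial y^b},\qquad \frac{\delta}{\delta x^a}=\frac{\partial}{\partial x^a}-G^b_a\frac{\partial}{\partial y^b},\qquad \delta y^a=dy^a+G^a_b\,dx^b .$$ On $TN^0$ let $V(N)$, locally spanned by the $\frac{\partial}{\partial y^a}$, and $H(N)$, locally spanned by the $\frac{\delta}{\delta x^a}$, be the vertical and horizontal distributions, let $Q$ and $Q^\perp$ be the projectors of $T(TN^0)=V(N)\oplus H(N)$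 onto $V(N)$ and $H(N)$, and let $$G=g_{ab}\,dx^a\otimes dx^b+g_{ab}\,\delta y^a\otimes\delta y^b$$ be the Sasaki–Finsler metric. Let $W=W(G)$ be a 1-form on $TN^0$, with local expression $W(G)=\rho_a\,dx^a+\theta_a\,\delta y^a$, and put $\rho^c=g^{cd}\rho_d$, $\theta^c=g^{cd}\theta_d$. A Weyl connection of $(TN^0,G,W)$ is a torsion-free linear connection $\tilde\nabla$ on $TN^0$ with $\tilde\nabla G+W\otimes G=0$, and its Vranceanu connection is $$\nabla^*_XY=Q\tilde\nabla_{QX}QY+Q^\perp\tilde\nabla_{Q^\perp X}Q^\perp Y+Q[Q^\perp X,QY]+Q^\perp[QX,Q^\perp Y].$$ Then a Weyl connection of $(TN^0,G,W)$ exists, and for every Weyl connection the following holds. In each chart of $N$ the fields $\frac{\partial}{\partial y^a},\frac{\delta}{\delta x^a}$ form a local frame of $T(TN^0)$, and with respect to it the Vranceanu connection is given by $$\nabla^*_{\frac{\partial}{\partial y^b}}\frac{\partial}{\partial y^a}=C^c_{ab}\frac{\partial}{\partial y^c},\quad \nabla^*_{\frac{\delta}{\delta x^b}}\frac{\partial}{\partial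 y^a}=D^c_{ab}\frac{\partial}{\partial y^c},\quad \nabla^*_{\frac{\partial}{\partial y^b}}\frac{\delta}{\delta x^a}=L^c_{ab}\frac{\delta}{\delta x^c},\quad \nabla^*_{\frac{\delta}{\delta x^b}}\frac{\delta}{\delta x^a}=F^c_{ab}\frac{\delta}{\delta x^c},$$ where, with $\delta^c_a$ the Kronecker symbol, $$C^c_{ab}=\tfrac12\Big(g^{cd}\frac{\partial g_{ab}}{\partial y^d}+\theta_a\delta^c_b+\theta_b\delta^c_a-\theta^cg_{ab}\Big),\qquad D^c_{ab}=\frac{\partial^2G^c}{\partial y^a\partial y^b},\qquad L^c_{ab}=0,$$ $$F^c_{ab}=\tfrac12g^{cd}\Big(\frac{\delta g_{db}}{\delta x^a}+\frac{\delta g_{ad}}{\delta x^b}-\frac{\delta g_{ab}}{\delta x^d}\Big)+\tfrac12\big(\rho_a\delta^c_b+\rho_b\delta^c_a-\rho^cg_{ab}\big).$$ -/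

import Mathlib

open Set
open scoped Manifold ContDiff Matrix

noncomputable section

namespace FinslerWeyl

/-- The model space of an `n`-dimensional real manifold. -/
abbrev Mod (n : ℕ) : Type := EuclideanSpace ℝ (Fin n)

/-! ### Calculus in the coordinates `(x, y)` of an induced chart -/

/-- The coordinate vector `∂/∂x^a` of `ℝⁿ × ℝⁿ`. -/
def ex {n : ℕ} (a : Fin n) : Mod n × Mod n := (EuclideanSpace.single a 1, 0)

/-- The coordinate vector `∂/∂y^a` of `ℝⁿ × ℝⁿ`. -/
def ey {n : ℕ} (a : Fin n) : Mod n × Mod n := (0, EuclideanSpace.single a 1)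

/-- The partial derivative `∂f/∂x^a`. -/
def dx {n : ℕ} (a : Fin n) (f : Mod n × Mod n → ℝ) (z : Mod n × Mod n) : ℝ :=
  fderiv ℝ f z (ex a)

/-- The partial derivative `∂f/∂y^a`. -/
def dy {n : ℕ} (a : Fin n) (f : Mod n × Mod n → ℝ) (z : Mod n × Mod n) : ℝ :=
  fderiv ℝ f z (ey a)

section Manifold

variable {n : ℕ} {N : Type*} [TopologicalSpace N] [ChartedSpace (Mod n) N]

/-- The coordinates `(x^a, y^a)` induced on `TN` by a chart `e = (x^a)` of `N`
(meaningful over the domain of `e`). -/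
def coord (e : OpenPartialHomeomorph N (Mod n)) (p : TangentBundle (𝓡 n) N) :
    Mod n × Mod n :=
  (e p.1, mfderiv (𝓡 n) (𝓡 n) e p.1 p.2)

/-- The local parametrization of `TN` by the coordinates `(x^a, y^a)` induced by `e`:
the inverse of `coord e`. -/
def param (e : OpenPartialHomeomorph N (Mod n)) (z : Mod n × Mod n) :
    TangentBundle (𝓡 n) N :=
  ⟨e.symm z.1, mfderiv (𝓡 n) (𝓡 n) e.symm z.1 z.2⟩

/-- The function `F²` in the coordinates induced by `e`. -/
def FSq (F : TangentBundle (𝓡 n) N → ℝ) (e : OpenPartialHomeomorph N (Mod n))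
    (z : Mod n × Mod n) : ℝ :=
  F (param e z) ^ 2

/-- The matrix `g_{bc} = ½ ∂²F²/∂y^b∂y^c` in the coordinates induced by `e`. -/
def gMat (F : TangentBundle (𝓡 n) N → ℝ) (e : OpenPartialHomeomorph N (Mod n))
    (z : Mod n × Mod n) : Matrix (Fin n) (Fin n) ℝ :=
  Matrix.of fun b c ↦ 1 / 2 * dy b (dy c (FSq F e)) z

/-- The functions `G^a = ¼ g^{ab} (∂²F²/∂y^b∂x^c y^c - ∂F²/∂x^b)`. -/
def spray (F : TangentBundle (𝓡 n) N → ℝ) (e : OpenPartialHomeomorph N (Mod n))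
    (a : Fin n) (z : Mod n × Mod n) : ℝ :=
  1 / 4 * ∑ b, (gMat F e z)⁻¹ a b *
    ((∑ c, dy b (dx c (FSq F e)) z * z.2 c) - dx b (FSq F e) z)

/-- The functions `G^a_b = ∂G^a/∂y^b`. -/
def nonlin (F : TangentBundle (𝓡 n) N → ℝ) (e : OpenPartialHomeomorph N (Mod n))
    (a b : Fin n) (z : Mod n × Mod n) : ℝ :=
  dy b (spray F e a) z

/-- The derivative `δf/δx^a = ∂f/∂x^a - G^b_a ∂f/∂y^b` of a function of the coordinates. -/
def deltaX (F : TangentBundle (𝓡 n) N → ℝ) (e : OpenPartialHomeomorph N (Mod n))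
    (a : Fin n) (f : Mod n × Mod n → ℝ) (z : Mod n × Mod n) : ℝ :=
  dx a f z - ∑ b, nonlin F e b a z * dy b f z

variable (n N) in
/-- The slit tangent bundle `TN⁰ = TN ∖ 0(N)`, an open subset of `TN`. -/
def slit : Set (TangentBundle (𝓡 n) N) := {p | p.2 ≠ 0}

section Smooth

variable [IsManifold (𝓡 n) ∞ N]

/-- `F` is a Finsler fundamental function on `N`: nonnegative, smooth on `TN⁰`, zero exactly on the
zero section, positively homogeneous of degree one on the fibers, and with positive definite
matrix `[g_{bc}]` on `TN⁰` in every local chart. -/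
structure IsFinsler (F : TangentBundle (𝓡 n) N → ℝ) : Prop where
  nonneg : ∀ p, 0 ≤ F p
  smooth : ContMDiffOn (𝓡 n).tangent 𝓘(ℝ) ∞ F (slit n N)
  eq_zero_iff : ∀ p, F p = 0 ↔ p.2 = 0
  homogeneous : ∀ (x : N) (v : TangentSpace (𝓡 n) x) (t : ℝ), 0 < t →
    F ⟨x, t • v⟩ = t * F ⟨x, v⟩
  posDef : ∀ e ∈ IsManifold.maximalAtlas (𝓡 n) ∞ N, ∀ x ∈ e.target, ∀ y : Mod n, y ≠ 0 →
    (gMat F e (x, y)).PosDef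

/-! ### The frame `{δ/δx^a, ∂/∂y^a}` on `TN` and its dual `{dx^a, δy^a}` in a chart -/

/-- The vector field `∂/∂y^a` in the coordinates `(x, y)`. -/
def coordFieldV (a : Fin n) (z : Mod n × Mod n) : TangentSpace 𝓘(ℝ, Mod n × Mod n) z :=
  ey a

/-- The vector field `∂/∂x^a - G^b_a ∂/∂y^b` in the coordinates `(x, y)` induced by `e`. -/
def coordFieldH (F : TangentBundle (𝓡 n) N → ℝ) (e : OpenPartialHomeomorph N (Mod n)) (a : Fin n)
    (z : Mod n × Mod n) : TangentSpace 𝓘(ℝ, Mod n × Mod n) z :=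
  ex a - ∑ b, nonlin F e b a z • ey b

/-- The vector field `∂/∂y^a` on the part of `TN` over the domain of `e`. -/
def frameV (e : OpenPartialHomeomorph N (Mod n)) (a : Fin n)
    (p : TangentBundle (𝓡 n) N) : TangentSpace (𝓡 n).tangent p :=
  VectorField.mpullback (𝓡 n).tangent 𝓘(ℝ, Mod n × Mod n) (coord e) (coordFieldV a) p

/-- The vector field `δ/δx^a = ∂/∂x^a - G^b_a ∂/∂y^b` on the part of `TN⁰` over the domain
of `e`. -/
def frameH (F : TangentBundle (𝓡 n) N → ℝ) (e : OpenPartialHomeomorph N (Mod n)) (a : Fin n)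
    (p : TangentBundle (𝓡 n) N) : TangentSpace (𝓡 n).tangent p :=
  VectorField.mpullback (𝓡 n).tangent 𝓘(ℝ, Mod n × Mod n) (coord e)
    (coordFieldH F e a) p

/-- The differential of the coordinates induced by `e`, applied to a tangent vector of `TN`. -/
def dcoord (e : OpenPartialHomeomorph N (Mod n)) (p : TangentBundle (𝓡 n) N)
    (v : TangentSpace (𝓡 n).tangent p) : Mod n × Mod n :=
  mfderiv (𝓡 n).tangent 𝓘(ℝ, Mod n × Mod n) (coord e) p v

/-- The 1-form `dx^a`. -/
def coframeH (e : OpenPartialHomeomorph N (Mod n)) (a : Fin n) (p : TangentBundle (𝓡 n) N)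
    (v : TangentSpace (𝓡 n).tangent p) : ℝ :=
  (dcoord e p v).1 a

/-- The 1-form `δy^a = dy^a + G^a_b dx^b`. -/
def coframeV (F : TangentBundle (𝓡 n) N → ℝ) (e : OpenPartialHomeomorph N (Mod n)) (a : Fin n)
    (p : TangentBundle (𝓡 n) N) (v : TangentSpace (𝓡 n).tangent p) : ℝ :=
  (dcoord e p v).2 a + ∑ b, nonlin F e a b (coord e p) * (dcoord e p v).1 b

/-! ### Global objects on `TN⁰`

At a point of `TN` they are computed in the preferred chart of `N` at its base point; since
`F` is a Finsler function they do not depend on this choice of a chart. -/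

/-- The preferred chart of `N` at the base point of `p`. -/
def chart (p : TangentBundle (𝓡 n) N) : OpenPartialHomeomorph N (Mod n) :=
  chartAt (Mod n) p.1

/-- The projector `Q` of `T(TN⁰) = H(N) ⊕ V(N)` onto the vertical distribution `V(N)`. -/
def projV (F : TangentBundle (𝓡 n) N → ℝ) (X : ∀ p : TangentBundle (𝓡 n) N, TangentSpace (𝓡 n).tangent p)
    (p : TangentBundle (𝓡 n) N) : TangentSpace (𝓡 n).tangent p :=
  ∑ a, coframeV F (chart p) a p (X p) • frameV (chart p) a p

/-- The projector `Q^⊥` of `T(TN⁰) = H(N) ⊕ V(N)` onto the horizontal distribution `H(N)`. -/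
def projH (F : TangentBundle (𝓡 n) N → ℝ) (X : ∀ p : TangentBundle (𝓡 n) N, TangentSpace (𝓡 n).tangent p)
    (p : TangentBundle (𝓡 n) N) : TangentSpace (𝓡 n).tangent p :=
  ∑ a, coframeH (chart p) a p (X p) • frameH F (chart p) a p

/-- The Sasaki–Finsler metric `G = g_{ab} dx^a dx^b + g_{ab} δy^a δy^b`. -/
def sasaki (F : TangentBundle (𝓡 n) N → ℝ) (p : TangentBundle (𝓡 n) N)
    (v w : TangentSpace (𝓡 n).tangent p) : ℝ :=
  ∑ a, ∑ b, gMat F (chart p) (coord (chart p) p) a b *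
    (coframeH (chart p) a p v * coframeH (chart p) b p w +
      coframeV F (chart p) a p v * coframeV F (chart p) b p w)

/-- The derivative `v(f)` of a function `f` on `TN` in the direction of a tangent vector `v`. -/
def dirDeriv (f : TangentBundle (𝓡 n) N → ℝ) (p : TangentBundle (𝓡 n) N)
    (v : TangentSpace (𝓡 n).tangent p) : ℝ :=
  mfderiv (𝓡 n).tangent 𝓘(ℝ) f p v

/-- `D` is the Weyl connection of `(TN⁰, G, W)`: a linear connection on `TN⁰` which is torsion-free
and satisfies `∇G + W ⊗ G = 0`. Here `D Y p v` is `(∇_v Y)(p)` and `W` is the 1-form associated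
with the metric `G` by the Weyl structure. -/
structure IsWeylConnection (F : TangentBundle (𝓡 n) N → ℝ)
    (W : ∀ p : TangentBundle (𝓡 n) N, TangentSpace (𝓡 n).tangent p →L[ℝ] ℝ)
    (D : (∀ p : TangentBundle (𝓡 n) N, TangentSpace (𝓡 n).tangent p) →
      ∀ p : TangentBundle (𝓡 n) N,
        TangentSpace (𝓡 n).tangent p →L[ℝ] TangentSpace (𝓡 n).tangent p) : Prop where
  isCovariantDerivativeOn :
    IsCovariantDerivativeOn (I := (𝓡 n).tangent) (Mod n × Mod n) D (slit n N)
  torsion_free : ∀ p ∈ slit n N, ∀ X Y : ∀ q, TangentSpace (𝓡 n).tangent q,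
    MDiffAt (T% X) p → MDiffAt (T% Y) p →
      D Y p (X p) - D X p (Y p) = VectorField.mlieBracket (𝓡 n).tangent X Y p
  compatible : ∀ p ∈ slit n N, ∀ X Y Z : ∀ q, TangentSpace (𝓡 n).tangent q,
    MDiffAt (T% X) p → MDiffAt (T% Y) p → MDiffAt (T% Z) p →
      dirDeriv (fun q ↦ sasaki F q (Y q) (Z q)) p (X p)
        - sasaki F p (D Y p (X p)) (Z p) - sasaki F p (Y p) (D Z p (X p))
        + W p (X p) * sasaki F p (Y p) (Z p) = 0

/-- The Vranceanu connection, defined by a linear connection `D` and the distribution `V(N)` with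
complement `H(N)`: `vranceanu F D X Y` is the vector field
`∇*_X Y = Q D_{QX} QY + Q^⊥ D_{Q^⊥X} Q^⊥Y + Q[Q^⊥X, QY] + Q^⊥[QX, Q^⊥Y]`. -/
def vranceanu (F : TangentBundle (𝓡 n) N → ℝ)
    (D : (∀ p : TangentBundle (𝓡 n) N, TangentSpace (𝓡 n).tangent p) →
      ∀ p : TangentBundle (𝓡 n) N,
        TangentSpace (𝓡 n).tangent p →L[ℝ] TangentSpace (𝓡 n).tangent p)
    (X Y : ∀ p : TangentBundle (𝓡 n) N, TangentSpace (𝓡 n).tangent p) (p : TangentBundle (𝓡 n) N) :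
    TangentSpace (𝓡 n).tangent p :=
  projV F (fun q ↦ D (projV F Y) q (projV F X q)) p
    + projH F (fun q ↦ D (projH F Y) q (projH F X q)) p
    + projV F (VectorField.mlieBracket (𝓡 n).tangent (projH F X) (projV F Y)) p
    + projH F (VectorField.mlieBracket (𝓡 n).tangent (projV F X) (projH F Y)) p

end Smooth

end Manifold

/-- The Kronecker symbol. -/
def kron {n : ℕ} (a b : Fin n) : ℝ := if a = b then 1 else 0

end FinslerWeyl

end

/-!
The proof has three ingredients.

*Independence of the chart.* The projectors and the Sasaki–Finsler metric are computed at each point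
of `TN` in the preferred chart of its base point, so differentiating them requires their expression
in one fixed chart. The functions `G^a` are determined by the property that the second order vector
`(y, -2G)` solves the Euler–Lagrange equations of `F²` (`eulerLagrange_spray`). These equations are
invariant under changes of coordinates (`eulerLagrange_comp_tanMap`), which gives the transformation
law `G' = A G - ½ B(y, y)` with `A`, `B` the first and second derivatives of the change of chart
(`sprayVec_trans`); its derivative along the fiber is the law of `G^a_b` (`nonlinVec_trans`). Hence
`dx^a` and `δy^a` transform with the same matrix `A`, and `projV_eq`, `projH_eq`, `sasaki_eq` hold
in every chart.

*Existence.* At a point `p`, a Weyl connection is the flat connection of the preferred chart plus a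
Christoffel term, solved from the Koszul formula by nondegeneracy of the metric
(`exists_christoffel`). The axioms of a Weyl connection at `p` involve only first derivatives at `p`
of the fields and of the metric, so that the choices at different points need not be related.

*The coefficients.* A linear connection is local, so that near `p` one may replace `Q` and `Q^⊥` of
the frame fields by these fields or by zero. The mixed coefficients are then read off from the
brackets of the frame. The other ones follow from the Koszul formula (`IsWeylConnection.koszul`): it
only involves derivatives of `g`, since vertical fields of the frame commute and the brackets of
horizontal ones are vertical, that is orthogonal to `H(N)`. In the vertical case the three
derivatives of `g` coincide by the symmetry of the third derivatives of `F²` (`dy_gMat_symm`).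
-/

noncomputable section

namespace FinslerWeyl

/-! ### Second derivatives of a Lagrangian under a tangent map -/

section TangentLift

variable {E : Type*} [NormedAddCommGroup E] [NormedSpace ℝ E]

/-- The tangent map of `φ` in coordinates: `(x, y) ↦ (φ(x), Dφ(x) y)`. -/
def tanMap (φ : E → E) (z : E × E) : E × E := (φ z.1, fderiv ℝ φ z.1 z.2)

/-- The derivative of `tanMap φ`. -/
def tanMapDeriv (φ : E → E) (z : E × E) : E × E →L[ℝ] E × E :=
  ((fderiv ℝ φ z.1).comp (.fst ℝ E E)).prod
    (((fderiv ℝ (fderiv ℝ φ) z.1).flip z.2).comp (.fst ℝ E E) +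
      (fderiv ℝ φ z.1).comp (.snd ℝ E E))

lemma tanMapDeriv_apply (φ : E → E) (z S : E × E) :
    tanMapDeriv φ z S = (fderiv ℝ φ z.1 S.1,
      fderiv ℝ (fderiv ℝ φ) z.1 S.1 z.2 + fderiv ℝ φ z.1 S.2) := rfl

lemma differentiableAt_fderiv {F G : Type*} [NormedAddCommGroup F] [NormedSpace ℝ F]
    [NormedAddCommGroup G] [NormedSpace ℝ G] {f : F → G} {x : F} (hf : ContDiffAt ℝ 2 f x) :
    DifferentiableAt ℝ (fderiv ℝ f) x :=
  (hf.fderiv_right (m := 1) (by norm_num)).differentiableAt (by simp)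

lemma hasFDerivAt_tanMap {φ : E → E} {z : E × E} (hφ : ContDiffAt ℝ 2 φ z.1) :
    HasFDerivAt (tanMap φ) (tanMapDeriv φ z) z := by
  have h1 : HasFDerivAt (fun z : E × E ↦ φ z.1) ((fderiv ℝ φ z.1).comp (.fst ℝ E E)) z :=
    (hφ.differentiableAt (by simp)).hasFDerivAt.comp z hasFDerivAt_fst
  have h2 : HasFDerivAt (fun z : E × E ↦ fderiv ℝ φ z.1)
      ((fderiv ℝ (fderiv ℝ φ) z.1).comp (.fst ℝ E E)) z :=
    (differentiableAt_fderiv hφ).hasFDerivAt.comp z hasFDerivAt_fst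
  have h3 := h2.clm_apply (hasFDerivAt_snd (𝕜 := ℝ) (p := z))
  refine (h1.prodMk h3).congr_fderiv ?_
  ext S <;> simp [tanMapDeriv]

variable {φ : E → E} {L L' : E × E → ℝ} {z : E × E}

lemma fderiv_comp_tanMap (hφ : ContDiffAt ℝ 2 φ z.1) (hL' : ContDiffAt ℝ 2 L' (tanMap φ z))
    (hL : L =ᶠ[nhds z] L' ∘ tanMap φ) (S : E × E) :
    fderiv ℝ L z S = fderiv ℝ L' (tanMap φ z) (tanMapDeriv φ z S) := by
  rw [hL.fderiv_eq, ((hL'.differentiableAt (by simp)).hasFDerivAt.comp z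
    (hasFDerivAt_tanMap hφ)).fderiv]
  rfl

/-- The second derivative of `L' ∘ tanMap φ`, with one argument tangent to the fiber. -/
lemma fderiv_fderiv_comp_tanMap (hφ : ContDiffAt ℝ 2 φ z.1)
    (hL' : ContDiffAt ℝ 2 L' (tanMap φ z)) (hL : L =ᶠ[nhds z] L' ∘ tanMap φ)
    (hLz : ContDiffAt ℝ 2 L z) (S : E × E) (w : E) :
    fderiv ℝ (fderiv ℝ L) z S (0, w) =
      fderiv ℝ (fderiv ℝ L') (tanMap φ z) (tanMapDeriv φ z S) (0, fderiv ℝ φ z.1 w) +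
        fderiv ℝ L' (tanMap φ z) (0, fderiv ℝ (fderiv ℝ φ) z.1 S.1 w) := by
  -- Differentiate `DL(z)(0, w) = DL'(Tφ(z))(0, Dφ(x) w)` in the direction of `S`.
  have h0 : (fun u ↦ fderiv ℝ L u (0, w)) =ᶠ[nhds z]
      fun u ↦ fderiv ℝ L' (tanMap φ u) (0, fderiv ℝ φ u.1 w) := by
    have e1 : ∀ᶠ u in nhds z, ContDiffAt ℝ 2 φ u.1 :=
      continuousAt_fst.eventually (hφ.eventually (by simp))
    have e2 : ∀ᶠ u in nhds z, ContDiffAt ℝ 2 L' (tanMap φ u) :=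
      (hasFDerivAt_tanMap hφ).continuousAt.eventually (hL'.eventually (by simp))
    filter_upwards [e1, e2, hL.eventuallyEq_nhds] with u h1 h2 h3
    rw [fderiv_comp_tanMap h1 h2 h3, tanMapDeriv_apply]
    simp
  have h1 : HasFDerivAt (fun u ↦ fderiv ℝ L u (0, w))
      ((fderiv ℝ (fderiv ℝ L) z).flip (0, w)) z := by
    simpa using (differentiableAt_fderiv hLz).hasFDerivAt.clm_apply
      (hasFDerivAt_const ((0, w) : E × E) z)
  have h2 : HasFDerivAt (fun u : E × E ↦ fderiv ℝ φ u.1 w)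
      (((fderiv ℝ (fderiv ℝ φ) z.1).flip w).comp (.fst ℝ E E)) z := by
    refine (((differentiableAt_fderiv hφ).hasFDerivAt.comp z hasFDerivAt_fst).clm_apply
      (hasFDerivAt_const w z)).congr_fderiv ?_
    ext S <;> simp
  have h3 := ((differentiableAt_fderiv hL').hasFDerivAt.comp z (hasFDerivAt_tanMap hφ)).clm_apply
    ((hasFDerivAt_const (0 : E) z).prodMk h2)
  have h4 := h1.unique (h3.congr_of_eventuallyEq h0)
  have h5 := DFunLike.congr_fun h4 S
  simp at h5
  rw [h5, add_comm]

/-- The Euler–Lagrange expression of a Lagrangian `L(x, y)`: it vanishes for all `w` exactly when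
a second order vector `S = (y, s)` at `z = (x, y)` is the value of the Euler–Lagrange field. -/
def eulerLagrange (L : E × E → ℝ) (z S : E × E) (w : E) : ℝ :=
  fderiv ℝ (fderiv ℝ L) z S (0, w) - fderiv ℝ L z (w, 0)

lemma isSymm_of_contDiffAt {F G : Type*} [NormedAddCommGroup F] [NormedSpace ℝ F]
    [NormedAddCommGroup G] [NormedSpace ℝ G] {f : F → G} {x : F} (hf : ContDiffAt ℝ 2 f x)
    (u v : F) : fderiv ℝ (fderiv ℝ f) x u v = fderiv ℝ (fderiv ℝ f) x v u :=
  hf.isSymmSndFDerivAt (by simp) u v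

/-- The Euler–Lagrange expression does not depend on coordinates. -/
lemma eulerLagrange_comp_tanMap (hφ : ContDiffAt ℝ 2 φ z.1)
    (hL' : ContDiffAt ℝ 2 L' (tanMap φ z)) (hL : L =ᶠ[nhds z] L' ∘ tanMap φ)
    (hLz : ContDiffAt ℝ 2 L z) (s w : E) :
    eulerLagrange L z (z.2, s) w =
      eulerLagrange L' (tanMap φ z) (tanMapDeriv φ z (z.2, s)) (fderiv ℝ φ z.1 w) := by
  have h1 : tanMapDeriv φ z (w, 0) = (fderiv ℝ φ z.1 w, 0) +
      (0, fderiv ℝ (fderiv ℝ φ) z.1 z.2 w) := by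
    simp [tanMapDeriv_apply, isSymm_of_contDiffAt hφ z.2 w]
  rw [eulerLagrange, eulerLagrange, fderiv_fderiv_comp_tanMap hφ hL' hL hLz,
    fderiv_comp_tanMap hφ hL' hL, h1, map_add]
  ring

end TangentLift

/-! ### The charts of `TN` induced by the charts of `N` -/

section Coordinates

variable {n : ℕ} {N : Type*} [TopologicalSpace N] [ChartedSpace (Mod n) N]
  [IsManifold (𝓡 n) ∞ N] {e : OpenPartialHomeomorph N (Mod n)}

lemma contMDiffOn_coord (he : e ∈ IsManifold.maximalAtlas (𝓡 n) ∞ N) :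
    ContMDiffOn (𝓡 n).tangent 𝓘(ℝ, Mod n × Mod n) ∞ (coord e)
      (Bundle.TotalSpace.proj ⁻¹' e.source) := by
  have h1 : ContMDiffOn (𝓡 n) (𝓡 n) ∞ e e.source := contMDiffOn_of_mem_maximalAtlas he
  have h2 := h1.contMDiffOn_tangentMapWithin (m := ∞) (by simp) e.open_source.uniqueMDiffOn
  have h3 := (contMDiff_snd_tangentBundle_modelSpace (𝕜 := ℝ) (n := ∞) (Mod n)
    𝓘(ℝ, Mod n)).comp_contMDiffOn h2
  have h4 : ContMDiffOn (𝓡 n).tangent (𝓡 n) ∞ (fun p : TangentBundle (𝓡 n) N ↦ e p.1)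
      (Bundle.TotalSpace.proj ⁻¹' e.source) :=
    h1.comp (Bundle.contMDiff_proj (TangentSpace (𝓡 n) : N → Type _)).contMDiffOn (fun p hp ↦ hp)
  refine (h4.prodMk_space h3).congr fun p hp ↦ ?_
  have : mfderivWithin (𝓡 n) (𝓡 n) e e.source p.1 = mfderiv (𝓡 n) (𝓡 n) e p.1 :=
    mfderivWithin_of_isOpen e.open_source hp
  simp only [coord, Function.comp, tangentMapWithin, this]

lemma contMDiffOn_param (he : e ∈ IsManifold.maximalAtlas (𝓡 n) ∞ N) :
    ContMDiffOn 𝓘(ℝ, Mod n × Mod n) (𝓡 n).tangent ∞ (param e) (e.target ×ˢ univ) := by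
  have h1 : ContMDiffOn (𝓡 n) (𝓡 n) ∞ e.symm e.target := contMDiffOn_symm_of_mem_maximalAtlas he
  have h2 := h1.contMDiffOn_tangentMapWithin (m := ∞) (by simp) e.open_target.uniqueMDiffOn
  have h3 : ContMDiff 𝓘(ℝ, Mod n × Mod n) (𝓡 n).tangent ∞
      (fun z : Mod n × Mod n ↦ (⟨z.1, z.2⟩ : TangentBundle (𝓡 n) (Mod n))) := by
    rw [modelWithCornersSelf_prod]
    exact contMDiff_tangentBundleModelSpaceHomeomorph_symm (I := 𝓡 n)
  refine (h2.comp h3.contMDiffOn (s := e.target ×ˢ univ) (fun z hz ↦ hz.1)).congr fun z hz ↦ ?_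
  have : mfderivWithin (𝓡 n) (𝓡 n) e.symm e.target z.1 = mfderiv (𝓡 n) (𝓡 n) e.symm z.1 :=
    mfderivWithin_of_isOpen e.open_target hz.1
  change _ = (⟨_, mfderivWithin (𝓡 n) (𝓡 n) e.symm e.target z.1 z.2⟩ : TangentBundle (𝓡 n) N)
  rw [this]
  rfl

omit [IsManifold (𝓡 n) ∞ N] in
lemma mdifferentiable_of_mem_maximalAtlas (he : e ∈ IsManifold.maximalAtlas (𝓡 n) ∞ N) :
    e.MDifferentiable (𝓡 n) (𝓡 n) :=
  ⟨(contMDiffOn_of_mem_maximalAtlas he).mdifferentiableOn (by simp),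
    (contMDiffOn_symm_of_mem_maximalAtlas he).mdifferentiableOn (by simp)⟩

omit [IsManifold (𝓡 n) ∞ N] in
lemma param_coord (he : e ∈ IsManifold.maximalAtlas (𝓡 n) ∞ N) {p : TangentBundle (𝓡 n) N}
    (hp : p.1 ∈ e.source) : param e (coord e p) = p := by
  obtain ⟨x, v⟩ := p
  have hx : x ∈ e.source := hp
  have h := DFunLike.congr_fun ((mdifferentiable_of_mem_maximalAtlas he).symm_comp_deriv hx) v
  have h' : mfderiv (𝓡 n) (𝓡 n) e.symm (e x) (mfderiv (𝓡 n) (𝓡 n) e x v) = v := h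
  simp only [param, coord, Bundle.TotalSpace.mk.injEq]
  exact ⟨e.left_inv hx, heq_of_eq h'⟩

omit [IsManifold (𝓡 n) ∞ N] in
lemma coord_param (he : e ∈ IsManifold.maximalAtlas (𝓡 n) ∞ N) {z : Mod n × Mod n}
    (hz : z.1 ∈ e.target) : coord e (param e z) = z := by
  have h := DFunLike.congr_fun ((mdifferentiable_of_mem_maximalAtlas he).comp_symm_deriv hz) z.2
  exact Prod.ext (e.right_inv hz) h

/-- The induced chart `coord e` of `TN`, with inverse `param e`. -/
def coordHomeo (e : OpenPartialHomeomorph N (Mod n)) (he : e ∈ IsManifold.maximalAtlas (𝓡 n) ∞ N) :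
    OpenPartialHomeomorph (TangentBundle (𝓡 n) N) (Mod n × Mod n) where
  toFun := coord e
  invFun := param e
  source := Bundle.TotalSpace.proj ⁻¹' e.source
  target := e.target ×ˢ univ
  map_source' _ hp := ⟨e.map_source hp, mem_univ _⟩
  map_target' _ hz := e.map_target hz.1
  left_inv' _ hp := param_coord he hp
  right_inv' _ hz := coord_param he hz.1
  open_source := e.open_source.preimage (FiberBundle.continuous_proj (Mod n) _)
  open_target := e.open_target.prod isOpen_univ
  continuousOn_toFun := (contMDiffOn_coord he).continuousOn
  continuousOn_invFun := (contMDiffOn_param he).continuousOn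

lemma mdifferentiable_coordHomeo (he : e ∈ IsManifold.maximalAtlas (𝓡 n) ∞ N) :
    (coordHomeo e he).MDifferentiable (𝓡 n).tangent 𝓘(ℝ, Mod n × Mod n) :=
  ⟨(contMDiffOn_coord he).mdifferentiableOn (by simp),
    (contMDiffOn_param he).mdifferentiableOn (by simp)⟩

lemma contMDiffAt_coord (he : e ∈ IsManifold.maximalAtlas (𝓡 n) ∞ N) {p : TangentBundle (𝓡 n) N}
    (hp : p.1 ∈ e.source) :
    ContMDiffAt (𝓡 n).tangent 𝓘(ℝ, Mod n × Mod n) ∞ (coord e) p :=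
  (contMDiffOn_coord he).contMDiffAt ((coordHomeo e he).open_source.mem_nhds hp)

lemma contMDiffAt_param (he : e ∈ IsManifold.maximalAtlas (𝓡 n) ∞ N) {z : Mod n × Mod n}
    (hz : z.1 ∈ e.target) :
    ContMDiffAt 𝓘(ℝ, Mod n × Mod n) (𝓡 n).tangent ∞ (param e) z :=
  (contMDiffOn_param he).contMDiffAt ((coordHomeo e he).open_target.mem_nhds ⟨hz, mem_univ _⟩)

/-- The differential at `p` of the induced chart, as an isomorphism of `T_p(TN)` with `ℝⁿ × ℝⁿ`. -/
def coordEquiv (he : e ∈ IsManifold.maximalAtlas (𝓡 n) ∞ N) {p : TangentBundle (𝓡 n) N}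
    (hp : p.1 ∈ e.source) : TangentSpace (𝓡 n).tangent p ≃L[ℝ] Mod n × Mod n :=
  (mdifferentiable_coordHomeo he).mfderiv (x := p) hp

lemma coordEquiv_apply (he : e ∈ IsManifold.maximalAtlas (𝓡 n) ∞ N) {p : TangentBundle (𝓡 n) N}
    (hp : p.1 ∈ e.source) (v : TangentSpace (𝓡 n).tangent p) :
    coordEquiv he hp v = dcoord e p v := rfl

lemma mpullback_coord_apply (he : e ∈ IsManifold.maximalAtlas (𝓡 n) ∞ N)
    {p : TangentBundle (𝓡 n) N} (hp : p.1 ∈ e.source)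
    (X : ∀ z : Mod n × Mod n, TangentSpace 𝓘(ℝ, Mod n × Mod n) z) :
    VectorField.mpullback (𝓡 n).tangent 𝓘(ℝ, Mod n × Mod n) (coord e) X p =
      (coordEquiv he hp).symm (X (coord e p)) := by
  rw [VectorField.mpullback_apply]
  exact congrFun (congrArg _ (ContinuousLinearMap.inverse_equiv (coordEquiv he hp))) _

lemma isInvertible_mfderiv_coord (he : e ∈ IsManifold.maximalAtlas (𝓡 n) ∞ N)
    {p : TangentBundle (𝓡 n) N} (hp : p.1 ∈ e.source) :
    (mfderiv (𝓡 n).tangent 𝓘(ℝ, Mod n × Mod n) (coord e) p).IsInvertible :=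
  ⟨coordEquiv he hp, rfl⟩

lemma isInvertible_mfderiv_param (he : e ∈ IsManifold.maximalAtlas (𝓡 n) ∞ N)
    {p : TangentBundle (𝓡 n) N} (hp : p.1 ∈ e.source) :
    (mfderiv 𝓘(ℝ, Mod n × Mod n) (𝓡 n).tangent (param e) (coord e p)).IsInvertible :=
  ⟨(mdifferentiable_coordHomeo he).symm.mfderiv (x := coord e p)
    ((coordHomeo e he).map_source hp), rfl⟩

/-! ### Change of the chart of `N` -/

variable {e' : OpenPartialHomeomorph N (Mod n)}

omit [IsManifold (𝓡 n) ∞ N] in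
lemma coord_param_eq_tanMap (he : e ∈ IsManifold.maximalAtlas (𝓡 n) ∞ N)
    (he' : e' ∈ IsManifold.maximalAtlas (𝓡 n) ∞ N) {z : Mod n × Mod n}
    (hz : z.1 ∈ e.target) (hz' : e.symm z.1 ∈ e'.source) :
    coord e' (param e z) = tanMap (e' ∘ e.symm) z := by
  have hd : mfderiv (𝓡 n) (𝓡 n) (e' ∘ e.symm) z.1 =
      (mfderiv (𝓡 n) (𝓡 n) e' (e.symm z.1)).comp (mfderiv (𝓡 n) (𝓡 n) e.symm z.1) :=
    mfderiv_comp _ ((mdifferentiable_of_mem_maximalAtlas he').mdifferentiableAt hz')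
      ((mdifferentiable_of_mem_maximalAtlas he).mdifferentiableAt_symm hz)
  have h := DFunLike.congr_fun hd z.2
  rw [mfderiv_eq_fderiv] at h
  exact Prod.ext rfl h.symm

omit [IsManifold (𝓡 n) ∞ N] in
lemma coord_eq_tanMap (he : e ∈ IsManifold.maximalAtlas (𝓡 n) ∞ N)
    (he' : e' ∈ IsManifold.maximalAtlas (𝓡 n) ∞ N) {p : TangentBundle (𝓡 n) N}
    (hp : p.1 ∈ e.source) (hp' : p.1 ∈ e'.source) :
    coord e' p = tanMap (e' ∘ e.symm) (coord e p) := by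
  have hx : e.symm (e p.1) = p.1 := e.left_inv hp
  rw [← coord_param_eq_tanMap he he' (e.map_source hp) (by rwa [coord, hx]), param_coord he hp]

omit [IsManifold (𝓡 n) ∞ N] in
/-- The transition map `e' ∘ e⁻¹` is smooth. -/
lemma contDiffOn_transition (he : e ∈ IsManifold.maximalAtlas (𝓡 n) ∞ N)
    (he' : e' ∈ IsManifold.maximalAtlas (𝓡 n) ∞ N) :
    ContDiffOn ℝ ∞ (e' ∘ e.symm) (e.symm.trans e').source := by
  have h : ContMDiffOn (𝓡 n) (𝓡 n) ∞ (e' ∘ e.symm) (e.symm.trans e').source :=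
    (contMDiffOn_of_mem_maximalAtlas he').comp
      ((contMDiffOn_symm_of_mem_maximalAtlas he).mono fun _ hx ↦ hx.1) fun _ hx ↦ hx.2
  exact h.contDiffOn

end Coordinates

/-! ### Regularity of the coefficients, and the spray as an Euler–Lagrange field -/

section Calculus

variable {n : ℕ}

lemma sum_smul_single (u : Mod n) : ∑ a, u a • EuclideanSpace.single a (1 : ℝ) = u := by
  ext b
  simp [Finset.sum_apply, Pi.single_apply]

lemma sum_smul_ey (u : Mod n) : ∑ a, u a • ey a = ((0, u) : Mod n × Mod n) := by
  conv_rhs => rw [← sum_smul_single u]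
  ext <;> simp [ey, Prod.fst_sum, Prod.snd_sum]

lemma sum_smul_ex (u : Mod n) : ∑ a, u a • ex a = ((u, 0) : Mod n × Mod n) := by
  conv_rhs => rw [← sum_smul_single u]
  ext <;> simp [ex, Prod.fst_sum, Prod.snd_sum]

variable {f : Mod n × Mod n → ℝ} {s : Set (Mod n × Mod n)}

lemma contDiffOn_dx (hs : IsOpen s) (hf : ContDiffOn ℝ ∞ f s) (a : Fin n) :
    ContDiffOn ℝ ∞ (dx a f) s :=
  (hf.fderiv_of_isOpen hs (m := ∞) (by simp)).clm_apply contDiffOn_const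

lemma contDiffOn_dy (hs : IsOpen s) (hf : ContDiffOn ℝ ∞ f s) (a : Fin n) :
    ContDiffOn ℝ ∞ (dy a f) s :=
  (hf.fderiv_of_isOpen hs (m := ∞) (by simp)).clm_apply contDiffOn_const

lemma fderiv_fderiv_apply {z : Mod n × Mod n} (hf : ContDiffAt ℝ 2 f z) (u v : Mod n × Mod n) :
    fderiv ℝ (fun w ↦ fderiv ℝ f w v) z u = fderiv ℝ (fderiv ℝ f) z u v := by
  rw [fderiv_clm_apply (differentiableAt_fderiv hf) (differentiableAt_const v)]
  simp

lemma contDiffOn_det {m : ℕ} {A : Mod n × Mod n → Matrix (Fin m) (Fin m) ℝ}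
    (hA : ∀ i j, ContDiffOn ℝ ∞ (fun z ↦ A z i j) s) :
    ContDiffOn ℝ ∞ (fun z ↦ (A z).det) s := by
  simp only [Matrix.det_apply, Units.smul_def, zsmul_eq_mul]
  exact ContDiffOn.sum fun σ _ ↦ contDiffOn_const.mul (contDiffOn_prod fun i _ ↦ hA _ _)

lemma contDiffOn_inv {m : ℕ} {A : Mod n × Mod n → Matrix (Fin m) (Fin m) ℝ}
    (hA : ∀ i j, ContDiffOn ℝ ∞ (fun z ↦ A z i j) s) (hdet : ∀ z ∈ s, (A z).det ≠ 0)
    (i j : Fin m) : ContDiffOn ℝ ∞ (fun z ↦ (A z)⁻¹ i j) s := by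
  simp only [Matrix.inv_def, Matrix.smul_apply, Ring.inverse_eq_inv', smul_eq_mul,
    Matrix.adjugate_apply]
  refine ((contDiffOn_det hA).inv hdet).mul (contDiffOn_det fun k l ↦ ?_)
  by_cases h : k = j
  · subst h
    simpa using contDiffOn_const
  · simpa [Matrix.updateRow_ne h] using hA k l

end Calculus

section Finsler

variable {n : ℕ} {N : Type*} [TopologicalSpace N] [ChartedSpace (Mod n) N]
  {F : TangentBundle (𝓡 n) N → ℝ} {e : OpenPartialHomeomorph N (Mod n)}

/-- The image of `TN⁰` in the coordinates induced by `e`. -/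
def slitDom (e : OpenPartialHomeomorph N (Mod n)) : Set (Mod n × Mod n) := e.target ×ˢ {0}ᶜ

omit [ChartedSpace (Mod n) N] in
lemma isOpen_slitDom : IsOpen (slitDom e) := e.open_target.prod isOpen_compl_singleton

lemma param_mem_slit (he : e ∈ IsManifold.maximalAtlas (𝓡 n) ∞ N) {z : Mod n × Mod n}
    (hz : z ∈ slitDom e) : param e z ∈ slit n N := by
  intro h
  have h1 : coord e (param e z) = z := coord_param he hz.1
  have h2 : z.2 = 0 := by
    rw [← h1, coord]
    simp only [h]
    exact map_zero _
  exact hz.2 h2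

lemma coord_mem_slitDom (he : e ∈ IsManifold.maximalAtlas (𝓡 n) ∞ N)
    {p : TangentBundle (𝓡 n) N} (hp : p ∈ slit n N) (hpe : p.1 ∈ e.source) :
    coord e p ∈ slitDom e :=
  ⟨e.map_source hpe, fun h ↦ hp <|
    (mdifferentiable_of_mem_maximalAtlas he).mfderiv_injective hpe (h.trans (map_zero _).symm)⟩

variable [IsManifold (𝓡 n) ∞ N]

lemma isOpen_slit_inter (he : e ∈ IsManifold.maximalAtlas (𝓡 n) ∞ N) :
    IsOpen (slit n N ∩ Bundle.TotalSpace.proj ⁻¹' e.source) := by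
  have h := (coordHomeo e he).isOpen_inter_preimage (isOpen_slitDom (e := e))
  convert h using 1
  ext p
  constructor
  · exact fun hp ↦ ⟨hp.2, coord_mem_slitDom he hp.1 hp.2⟩
  · rintro ⟨hp, hp'⟩
    refine ⟨?_, hp⟩
    rw [← param_coord he hp]
    exact param_mem_slit he hp'

lemma eventually_mem_slit_inter (he : e ∈ IsManifold.maximalAtlas (𝓡 n) ∞ N)
    {p : TangentBundle (𝓡 n) N} (hp : p ∈ slit n N) (hpe : p.1 ∈ e.source) :
    ∀ᶠ q in nhds p, q ∈ slit n N ∧ q.1 ∈ e.source :=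
  (isOpen_slit_inter he).mem_nhds ⟨hp, hpe⟩

lemma contDiffOn_FSq (hF : IsFinsler F) (he : e ∈ IsManifold.maximalAtlas (𝓡 n) ∞ N) :
    ContDiffOn ℝ ∞ (FSq F e) (slitDom e) := by
  have h : ContMDiffOn 𝓘(ℝ, Mod n × Mod n) 𝓘(ℝ) ∞ (F ∘ param e) (slitDom e) :=
    hF.smooth.comp ((contMDiffOn_param he).mono (prod_mono_right (subset_univ _)))
      fun z hz ↦ param_mem_slit he hz
  exact h.contDiffOn.pow 2

lemma contDiffAt_FSq (hF : IsFinsler F) (he : e ∈ IsManifold.maximalAtlas (𝓡 n) ∞ N)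
    {z : Mod n × Mod n} (hz : z ∈ slitDom e) : ContDiffAt ℝ 2 (FSq F e) z :=
  ((contDiffOn_FSq hF he).contDiffAt (isOpen_slitDom.mem_nhds hz)).of_le (by norm_cast)

lemma gMat_apply (hF : IsFinsler F) (he : e ∈ IsManifold.maximalAtlas (𝓡 n) ∞ N)
    {z : Mod n × Mod n} (hz : z ∈ slitDom e) (b c : Fin n) :
    gMat F e z b c = 1 / 2 * fderiv ℝ (fderiv ℝ (FSq F e)) z (ey b) (ey c) := by
  rw [← fderiv_fderiv_apply (contDiffAt_FSq hF he hz)]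
  rfl

lemma gMat_posDef (hF : IsFinsler F) (he : e ∈ IsManifold.maximalAtlas (𝓡 n) ∞ N)
    {z : Mod n × Mod n} (hz : z ∈ slitDom e) : (gMat F e z).PosDef :=
  hF.posDef e he z.1 hz.1 z.2 hz.2

lemma gMat_symm (hF : IsFinsler F) (he : e ∈ IsManifold.maximalAtlas (𝓡 n) ∞ N)
    {z : Mod n × Mod n} (hz : z ∈ slitDom e) (b c : Fin n) :
    gMat F e z b c = gMat F e z c b := by
  rw [gMat_apply hF he hz, gMat_apply hF he hz, isSymm_of_contDiffAt (contDiffAt_FSq hF he hz)]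

lemma gMat_mul_inv (hF : IsFinsler F) (he : e ∈ IsManifold.maximalAtlas (𝓡 n) ∞ N)
    {z : Mod n × Mod n} (hz : z ∈ slitDom e) : gMat F e z * (gMat F e z)⁻¹ = 1 :=
  Matrix.mul_nonsing_inv _ (gMat_posDef hF he hz).det_pos.ne'.isUnit

lemma contDiffOn_gMat (hF : IsFinsler F) (he : e ∈ IsManifold.maximalAtlas (𝓡 n) ∞ N)
    (b c : Fin n) : ContDiffOn ℝ ∞ (fun z ↦ gMat F e z b c) (slitDom e) :=
  contDiffOn_const.mul (contDiffOn_dy isOpen_slitDom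
    (contDiffOn_dy isOpen_slitDom (contDiffOn_FSq hF he) c) b)

lemma contDiffOn_spray (hF : IsFinsler F) (he : e ∈ IsManifold.maximalAtlas (𝓡 n) ∞ N)
    (a : Fin n) : ContDiffOn ℝ ∞ (spray F e a) (slitDom e) := by
  have hL := contDiffOn_FSq hF he
  refine contDiffOn_const.mul (ContDiffOn.sum fun b _ ↦ ?_)
  refine (contDiffOn_inv (contDiffOn_gMat hF he)
    (fun z hz ↦ (gMat_posDef hF he hz).det_pos.ne') a b).mul (ContDiffOn.sub ?_ ?_)
  · refine ContDiffOn.sum fun c _ ↦ ?_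
    refine (contDiffOn_dy isOpen_slitDom (contDiffOn_dx isOpen_slitDom hL c) b).mul ?_
    fun_prop
  · exact contDiffOn_dx isOpen_slitDom hL b

lemma contDiffOn_nonlin (hF : IsFinsler F) (he : e ∈ IsManifold.maximalAtlas (𝓡 n) ∞ N)
    (a b : Fin n) : ContDiffOn ℝ ∞ (nonlin F e a b) (slitDom e) :=
  contDiffOn_dy isOpen_slitDom (contDiffOn_spray hF he a) b

/-- Contraction of `g` with two vectors as a second derivative of `F²` along the fiber. -/
lemma sum_gMat (hF : IsFinsler F) (he : e ∈ IsManifold.maximalAtlas (𝓡 n) ∞ N)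
    {z : Mod n × Mod n} (hz : z ∈ slitDom e) (u w : Mod n) :
    ∑ a, ∑ b, gMat F e z a b * (u a * w b) =
      1 / 2 * fderiv ℝ (fderiv ℝ (FSq F e)) z (0, u) (0, w) := by
  simp only [← sum_smul_ey u, ← sum_smul_ey w, gMat_apply hF he hz, map_sum, map_smul,
    sum_apply, smul_apply, smul_eq_mul, Finset.mul_sum]
  rw [Finset.sum_comm]
  exact Finset.sum_congr rfl fun a _ ↦ Finset.sum_congr rfl fun b _ ↦ by ring

lemma sum_gMat_pos (hF : IsFinsler F) (he : e ∈ IsManifold.maximalAtlas (𝓡 n) ∞ N)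
    {z : Mod n × Mod n} (hz : z ∈ slitDom e) {u : Mod n} (hu : u ≠ 0) :
    0 < ∑ a, ∑ b, gMat F e z a b * (u a * u b) := by
  have h1 : (u.ofLp : Fin n → ℝ) ≠ 0 := fun h' ↦ hu (by ext a; exact congrFun h' a)
  refine ((gMat_posDef hF he hz).dotProduct_mulVec_pos h1).trans_eq ?_
  simp only [dotProduct, Matrix.mulVec, Finset.mul_sum]
  exact Finset.sum_congr rfl fun a _ ↦ Finset.sum_congr rfl fun b _ ↦ by simp; ring

/-- Nondegeneracy of the second derivative of `F²` along the fiber. -/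
lemma eq_zero_of_fderiv_fderiv_FSq (hF : IsFinsler F)
    (he : e ∈ IsManifold.maximalAtlas (𝓡 n) ∞ N)
    {z : Mod n × Mod n} (hz : z ∈ slitDom e) {u : Mod n}
    (hu : ∀ w : Mod n, fderiv ℝ (fderiv ℝ (FSq F e)) z (0, u) (0, w) = 0) : u = 0 := by
  by_contra h
  have h2 := sum_gMat_pos hF he hz h
  rw [sum_gMat hF he hz, hu u] at h2
  simp at h2

/-- The vector of the functions `G^a`. -/
def sprayVec (F : TangentBundle (𝓡 n) N → ℝ) (e : OpenPartialHomeomorph N (Mod n))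
    (z : Mod n × Mod n) : Mod n :=
  WithLp.toLp 2 fun a ↦ spray F e a z

lemma contDiffOn_sprayVec (hF : IsFinsler F) (he : e ∈ IsManifold.maximalAtlas (𝓡 n) ∞ N) :
    ContDiffOn ℝ ∞ (sprayVec F e) (slitDom e) :=
  (contDiffOn_piLp 2).2 fun a ↦ contDiffOn_spray hF he a

/-- The defining property of the functions `G^a`: the second order vector `(y, -2G)` satisfies the
Euler–Lagrange equations of `F²`. -/
lemma eulerLagrange_spray (hF : IsFinsler F) (he : e ∈ IsManifold.maximalAtlas (𝓡 n) ∞ N)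
    {z : Mod n × Mod n} (hz : z ∈ slitDom e) (w : Mod n) :
    eulerLagrange (FSq F e) z (z.2, (-2 : ℝ) • sprayVec F e z) w = 0 := by
  set L := FSq F e with hL
  have hLz := contDiffAt_FSq hF he hz
  -- It suffices to treat the coordinate vectors `w`.
  suffices H : ∀ b : Fin n, eulerLagrange L z (z.2, (-2 : ℝ) • sprayVec F e z)
      (EuclideanSpace.single b 1) = 0 by
    rw [eulerLagrange, ← sum_smul_ey w, ← sum_smul_ex w]
    simp only [map_sum, map_smul, smul_eq_mul, ← Finset.sum_sub_distrib, ← mul_sub]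
    exact Finset.sum_eq_zero fun b _ ↦ mul_eq_zero_of_right _ (H b)
  intro b
  have h1 : ((z.2, (-2 : ℝ) • sprayVec F e z) : Mod n × Mod n) =
      ∑ c, z.2 c • ex c + (-2 : ℝ) • ∑ a, spray F e a z • ey a := by
    rw [sum_smul_ex, show ∑ a, spray F e a z • ey a = ((0, sprayVec F e z) : Mod n × Mod n) from
      sum_smul_ey (sprayVec F e z)]
    simp
  have h2 : ∀ c, fderiv ℝ (fderiv ℝ L) z (ex c) (ey b) = dy b (dx c L) z := fun c ↦ by
    rw [isSymm_of_contDiffAt hLz, ← fderiv_fderiv_apply hLz]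
    rfl
  have h3 : ∀ a, fderiv ℝ (fderiv ℝ L) z (ey a) (ey b) = 2 * gMat F e z b a := fun a ↦ by
    rw [gMat_apply hF he hz, isSymm_of_contDiffAt hLz]
    ring
  have h4 : ∑ a, gMat F e z b a * (4 * spray F e a z) =
      (∑ c, dy b (dx c L) z * z.2 c) - dx b L z := by
    have h5 : ∀ a, 4 * spray F e a z = ((gMat F e z)⁻¹ *ᵥ fun b ↦
        ((∑ c, dy b (dx c L) z * z.2 c) - dx b L z)) a := fun a ↦ by
      simp only [spray, Matrix.mulVec, dotProduct, hL]
      ring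
    simp only [h5]
    change (gMat F e z *ᵥ _) b = _
    rw [Matrix.mulVec_mulVec, gMat_mul_inv hF he hz, Matrix.one_mulVec]
  have h6 : fderiv ℝ L z (EuclideanSpace.single b 1, 0) = dx b L z := rfl
  rw [eulerLagrange, h6, h1]
  change fderiv ℝ (fderiv ℝ L) z _ (ey b) - _ = 0
  simp only [map_add, map_smul, map_sum, add_apply,
    smul_apply, sum_apply, h2, h3, smul_eq_mul]
  have h7 : ∑ a, gMat F e z b a * (4 * spray F e a z) =
      2 * ∑ a, spray F e a z * (2 * gMat F e z b a) := by
    rw [Finset.mul_sum]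
    exact Finset.sum_congr rfl fun a _ ↦ by ring
  have h8 : ∑ c, z.2 c * dy b (dx c L) z = ∑ c, dy b (dx c L) z * z.2 c :=
    Finset.sum_congr rfl fun c _ ↦ mul_comm _ _
  linarith

/-- The vector with components `G^a_b u^b`. -/
def nonlinVec (F : TangentBundle (𝓡 n) N → ℝ) (e : OpenPartialHomeomorph N (Mod n))
    (z : Mod n × Mod n) (u : Mod n) : Mod n :=
  WithLp.toLp 2 fun a ↦ ∑ b, nonlin F e a b z * u b

lemma nonlinVec_eq (hF : IsFinsler F) (he : e ∈ IsManifold.maximalAtlas (𝓡 n) ∞ N)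
    {z : Mod n × Mod n} (hz : z ∈ slitDom e) (u : Mod n) :
    nonlinVec F e z u = fderiv ℝ (sprayVec F e) z (0, u) := by
  have h1 : DifferentiableAt ℝ (sprayVec F e) z :=
    ((contDiffOn_sprayVec hF he).contDiffAt (isOpen_slitDom.mem_nhds hz)).differentiableAt (by simp)
  ext a
  have h2 := ((PiLp.proj 2 (fun _ : Fin n ↦ ℝ) a : Mod n →L[ℝ] ℝ).hasFDerivAt.comp z
    h1.hasFDerivAt).fderiv
  have h3 : fderiv ℝ (spray F e a) z (0, u) = fderiv ℝ (sprayVec F e) z (0, u) a :=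
    DFunLike.congr_fun h2 (0, u)
  rw [← h3, ← sum_smul_ey]
  simp only [map_sum, map_smul, nonlinVec, smul_eq_mul]
  exact Finset.sum_congr rfl fun b _ ↦ mul_comm _ _

end Finsler

/-! ### Independence of the chart -/

section Invariance

variable {n : ℕ} {N : Type*} [TopologicalSpace N] [ChartedSpace (Mod n) N]
  [IsManifold (𝓡 n) ∞ N] {F : TangentBundle (𝓡 n) N → ℝ}
  {e e' : OpenPartialHomeomorph N (Mod n)}

/-- The part of `slitDom e` that lies over the domain of a second chart `e'`. -/
def overlap (e e' : OpenPartialHomeomorph N (Mod n)) : Set (Mod n × Mod n) :=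
  slitDom e ∩ Prod.fst ⁻¹' (e.symm.trans e').source

omit [ChartedSpace (Mod n) N] [IsManifold (𝓡 n) ∞ N] in
lemma isOpen_overlap : IsOpen (overlap e e') :=
  isOpen_slitDom.inter ((e.symm.trans e').open_source.preimage continuous_fst)

omit [IsManifold (𝓡 n) ∞ N] in
lemma contDiffAt_transition (he : e ∈ IsManifold.maximalAtlas (𝓡 n) ∞ N)
    (he' : e' ∈ IsManifold.maximalAtlas (𝓡 n) ∞ N) {z : Mod n × Mod n} (hz : z ∈ overlap e e') :
    ContDiffAt ℝ 2 (e' ∘ e.symm) z.1 :=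
  ((contDiffOn_transition he he').contDiffAt
    ((e.symm.trans e').open_source.mem_nhds hz.2)).of_le (by norm_cast)

omit [IsManifold (𝓡 n) ∞ N] in
lemma coord_mem_overlap (he : e ∈ IsManifold.maximalAtlas (𝓡 n) ∞ N)
    {p : TangentBundle (𝓡 n) N} (hp : p ∈ slit n N) (hpe : p.1 ∈ e.source)
    (hpe' : p.1 ∈ e'.source) : coord e p ∈ overlap e e' :=
  ⟨coord_mem_slitDom he hp hpe, e.map_source hpe, by
    change e.symm (e p.1) ∈ e'.source
    rwa [e.left_inv hpe]⟩

omit [IsManifold (𝓡 n) ∞ N] in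
lemma tanMap_mem_slitDom (he : e ∈ IsManifold.maximalAtlas (𝓡 n) ∞ N)
    (he' : e' ∈ IsManifold.maximalAtlas (𝓡 n) ∞ N) {z : Mod n × Mod n} (hz : z ∈ overlap e e') :
    tanMap (e' ∘ e.symm) z ∈ slitDom e' := by
  rw [← coord_param_eq_tanMap he he' hz.2.1 hz.2.2]
  exact coord_mem_slitDom he' (param_mem_slit he hz.1) hz.2.2

omit [IsManifold (𝓡 n) ∞ N] in
lemma FSq_eventuallyEq (he : e ∈ IsManifold.maximalAtlas (𝓡 n) ∞ N)
    (he' : e' ∈ IsManifold.maximalAtlas (𝓡 n) ∞ N) {z : Mod n × Mod n} (hz : z ∈ overlap e e') :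
    FSq F e =ᶠ[nhds z] FSq F e' ∘ tanMap (e' ∘ e.symm) := by
  filter_upwards [isOpen_overlap.mem_nhds hz] with u hu
  rw [Function.comp_apply, ← coord_param_eq_tanMap he he' hu.2.1 hu.2.2, FSq, FSq,
    param_coord he' (show (param e u).1 ∈ e'.source from hu.2.2)]

lemma dcoord_eq (he : e ∈ IsManifold.maximalAtlas (𝓡 n) ∞ N)
    (he' : e' ∈ IsManifold.maximalAtlas (𝓡 n) ∞ N)
    {p : TangentBundle (𝓡 n) N} (hp : p ∈ slit n N) (hpe : p.1 ∈ e.source)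
    (hpe' : p.1 ∈ e'.source) (v : TangentSpace (𝓡 n).tangent p) :
    dcoord e' p v = tanMapDeriv (e' ∘ e.symm) (coord e p) (dcoord e p v) := by
  have h1 : coord e' =ᶠ[nhds p] tanMap (e' ∘ e.symm) ∘ coord e := by
    filter_upwards [eventually_mem_slit_inter he hp hpe,
      eventually_mem_slit_inter he' hp hpe'] with q hq hq'
    exact coord_eq_tanMap he he' hq.2 hq'.2
  have h2 := hasFDerivAt_tanMap (contDiffAt_transition he he' (coord_mem_overlap he hp hpe hpe'))
  have h3 := (contMDiffAt_coord he hpe).mdifferentiableAt (by simp)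
  have h4 := (h2.hasMFDerivAt.comp p h3.hasMFDerivAt).congr_of_eventuallyEq h1
  exact DFunLike.congr_fun h4.mfderiv v

/-- The transformation law of the matrix `g`. -/
lemma fderiv_fderiv_FSq_trans (hF : IsFinsler F) (he : e ∈ IsManifold.maximalAtlas (𝓡 n) ∞ N)
    (he' : e' ∈ IsManifold.maximalAtlas (𝓡 n) ∞ N) {z : Mod n × Mod n} (hz : z ∈ overlap e e')
    (u w : Mod n) :
    fderiv ℝ (fderiv ℝ (FSq F e')) (tanMap (e' ∘ e.symm) z)
        (0, fderiv ℝ (e' ∘ e.symm) z.1 u) (0, fderiv ℝ (e' ∘ e.symm) z.1 w) =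
      fderiv ℝ (fderiv ℝ (FSq F e)) z (0, u) (0, w) := by
  rw [fderiv_fderiv_comp_tanMap (contDiffAt_transition he he' hz)
    (contDiffAt_FSq hF he' (tanMap_mem_slitDom he he' hz)) (FSq_eventuallyEq he he' hz)
    (contDiffAt_FSq hF he hz.1), tanMapDeriv_apply]
  simp only [map_zero, zero_apply, zero_add]
  exact (add_eq_left.2 (map_zero _)).symm

omit [IsManifold (𝓡 n) ∞ N] in
lemma fderiv_transition_surjective (he : e ∈ IsManifold.maximalAtlas (𝓡 n) ∞ N)
    (he' : e' ∈ IsManifold.maximalAtlas (𝓡 n) ∞ N) {z : Mod n × Mod n} (hz : z ∈ overlap e e') :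
    Function.Surjective (fderiv ℝ (e' ∘ e.symm) z.1) := by
  have h := ((mdifferentiable_of_mem_maximalAtlas he).symm.trans
    (mdifferentiable_of_mem_maximalAtlas he')).mfderiv_surjective hz.2
  rwa [mfderiv_eq_fderiv] at h

/-- The transformation law of the functions `G^a`. -/
lemma sprayVec_trans (hF : IsFinsler F) (he : e ∈ IsManifold.maximalAtlas (𝓡 n) ∞ N)
    (he' : e' ∈ IsManifold.maximalAtlas (𝓡 n) ∞ N) {z : Mod n × Mod n} (hz : z ∈ overlap e e') :
    sprayVec F e' (tanMap (e' ∘ e.symm) z) =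
      fderiv ℝ (e' ∘ e.symm) z.1 (sprayVec F e z) -
        (1 / 2 : ℝ) • fderiv ℝ (fderiv ℝ (e' ∘ e.symm)) z.1 z.2 z.2 := by
  set φ := e' ∘ e.symm
  have hz' := tanMap_mem_slitDom he he' hz
  -- Both `(y', -2G')` and the image of `(y, -2G)` solve the Euler–Lagrange equations in `e'`.
  rw [← sub_eq_zero]
  refine eq_zero_of_fderiv_fderiv_FSq hF he' hz' fun w' ↦ ?_
  obtain ⟨w, rfl⟩ := fderiv_transition_surjective he he' hz w'
  have h1 := eulerLagrange_spray hF he hz.1 w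
  rw [eulerLagrange_comp_tanMap (contDiffAt_transition he he' hz)
    (contDiffAt_FSq hF he' hz') (FSq_eventuallyEq he he' hz) (contDiffAt_FSq hF he hz.1)] at h1
  have h2 := eulerLagrange_spray hF he' hz' (fderiv ℝ φ z.1 w)
  rw [eulerLagrange] at h1 h2
  have h3 : ((0, sprayVec F e' (tanMap φ z) - (fderiv ℝ φ z.1 (sprayVec F e z) -
      (1 / 2 : ℝ) • fderiv ℝ (fderiv ℝ φ) z.1 z.2 z.2)) : Mod n × Mod n) =
      (1 / 2 : ℝ) • (tanMapDeriv φ z (z.2, (-2 : ℝ) • sprayVec F e z) -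
        ((tanMap φ z).2, (-2 : ℝ) • sprayVec F e' (tanMap φ z))) := by
    rw [tanMapDeriv_apply, map_smul]
    refine Prod.ext ?_ ?_
    · simp [tanMap]
    · simp only [Prod.smul_snd, Prod.snd_sub]
      module
  rw [h3, map_smul, map_sub, smul_apply, sub_apply]
  have h4 := sub_eq_zero.1 h1
  have h5 := sub_eq_zero.1 h2
  rw [h4, h5, sub_self, smul_zero]

/-- The transformation law of the nonlinear connection `G^a_b`. -/
lemma nonlinVec_trans (hF : IsFinsler F) (he : e ∈ IsManifold.maximalAtlas (𝓡 n) ∞ N)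
    (he' : e' ∈ IsManifold.maximalAtlas (𝓡 n) ∞ N) {z : Mod n × Mod n} (hz : z ∈ overlap e e')
    (u : Mod n) :
    nonlinVec F e' (tanMap (e' ∘ e.symm) z) (fderiv ℝ (e' ∘ e.symm) z.1 u) =
      fderiv ℝ (e' ∘ e.symm) z.1 (nonlinVec F e z u) -
        fderiv ℝ (fderiv ℝ (e' ∘ e.symm)) z.1 u z.2 := by
  -- Differentiate the transformation law of `G^a` along the fiber.
  have hz' := tanMap_mem_slitDom he he' hz
  have hφ := contDiffAt_transition he he' hz
  set φ := e' ∘ e.symm with hφ_def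
  rw [nonlinVec_eq hF he' hz', nonlinVec_eq hF he hz.1]
  have hd : ∀ {e : OpenPartialHomeomorph N (Mod n)}, e ∈ IsManifold.maximalAtlas (𝓡 n) ∞ N →
      ∀ {z}, z ∈ slitDom e → HasFDerivAt (sprayVec F e) (fderiv ℝ (sprayVec F e) z) z :=
    fun he _ hz ↦ (((contDiffOn_sprayVec hF he).contDiffAt
      (isOpen_slitDom.mem_nhds hz)).differentiableAt (by simp)).hasFDerivAt
  have h1 := ((hd he' hz').comp z (hasFDerivAt_tanMap hφ))
  have hγ : HasFDerivAt (fun y : Mod n ↦ ((z.1, y) : Mod n × Mod n)) (.inr ℝ (Mod n) (Mod n)) z.2 :=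
    hasFDerivAt_prodMk_right z.1 z.2
  have h2 := HasFDerivAt.comp (g := sprayVec F e' ∘ tanMap φ) z.2 h1 hγ
  have h3 := HasFDerivAt.comp (g := sprayVec F e) z.2 (hd he hz.1) hγ
  have h4 := ((fderiv ℝ φ z.1).hasFDerivAt.comp z.2 h3).sub
    ((((fderiv ℝ (fderiv ℝ φ) z.1).hasFDerivAt).clm_apply (hasFDerivAt_id z.2)).const_smul
      (1 / 2 : ℝ))
  have h5 : ((sprayVec F e' ∘ tanMap φ) ∘ fun y ↦ (z.1, y)) =ᶠ[nhds z.2] _ :=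
    (show ∀ᶠ y in nhds z.2, (z.1, y) ∈ overlap e e' from
      hγ.continuousAt.eventually (isOpen_overlap.mem_nhds hz)).mono
      fun y hy ↦ sprayVec_trans hF he he' hy
  have h6 := DFunLike.congr_fun (h2.unique (h4.congr_of_eventuallyEq h5)) u
  have h7 : tanMapDeriv φ z (0, u) = (0, fderiv ℝ φ z.1 u) := by simp [tanMapDeriv_apply]
  simp only [ContinuousLinearMap.comp_apply, ContinuousLinearMap.inr_apply, h7, sub_apply,
    smul_apply, add_apply, ContinuousLinearMap.flip_apply, id,
    ContinuousLinearMap.id_apply] at h6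
  rw [h6, isSymm_of_contDiffAt hφ z.2 u]
  module

/-- The vector with components `δy^a(v)`: the vertical part of `v` in the chart `e`. -/
def vertPart (F : TangentBundle (𝓡 n) N → ℝ) (e : OpenPartialHomeomorph N (Mod n))
    (p : TangentBundle (𝓡 n) N) (v : TangentSpace (𝓡 n).tangent p) : Mod n :=
  WithLp.toLp 2 fun a ↦ coframeV F e a p v

lemma vertPart_eq (p : TangentBundle (𝓡 n) N) (v : TangentSpace (𝓡 n).tangent p) :
    vertPart F e p v = (dcoord e p v).2 + nonlinVec F e (coord e p) (dcoord e p v).1 := rfl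

variable {p : TangentBundle (𝓡 n) N}

lemma dcoord_fst_trans (he : e ∈ IsManifold.maximalAtlas (𝓡 n) ∞ N)
    (he' : e' ∈ IsManifold.maximalAtlas (𝓡 n) ∞ N) (hp : p ∈ slit n N) (hpe : p.1 ∈ e.source)
    (hpe' : p.1 ∈ e'.source) (v : TangentSpace (𝓡 n).tangent p) :
    (dcoord e' p v).1 = fderiv ℝ (e' ∘ e.symm) (coord e p).1 (dcoord e p v).1 := by
  rw [dcoord_eq he he' hp hpe hpe', tanMapDeriv_apply]

lemma vertPart_trans (hF : IsFinsler F) (he : e ∈ IsManifold.maximalAtlas (𝓡 n) ∞ N)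
    (he' : e' ∈ IsManifold.maximalAtlas (𝓡 n) ∞ N) (hp : p ∈ slit n N) (hpe : p.1 ∈ e.source)
    (hpe' : p.1 ∈ e'.source) (v : TangentSpace (𝓡 n).tangent p) :
    vertPart F e' p v = fderiv ℝ (e' ∘ e.symm) (coord e p).1 (vertPart F e p v) := by
  rw [vertPart_eq, vertPart_eq, dcoord_eq he he' hp hpe hpe', tanMapDeriv_apply,
    coord_eq_tanMap he he' hpe hpe',
    nonlinVec_trans hF he he' (coord_mem_overlap he hp hpe hpe'), map_add]
  have h : ∀ b u v : Mod n, b + u + (v - b) = u + v := fun b u v ↦ by abel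
  exact h _ _ _

lemma dcoord_symm_apply (he : e ∈ IsManifold.maximalAtlas (𝓡 n) ∞ N) (hpe : p.1 ∈ e.source)
    (u : Mod n × Mod n) : dcoord e p ((coordEquiv he hpe).symm u) = u :=
  (coordEquiv he hpe).apply_symm_apply u

lemma frameV_eq (he : e ∈ IsManifold.maximalAtlas (𝓡 n) ∞ N) (hpe : p.1 ∈ e.source) (a : Fin n) :
    frameV e a p = (coordEquiv he hpe).symm (ey a) :=
  mpullback_coord_apply he hpe _

lemma frameH_eq (he : e ∈ IsManifold.maximalAtlas (𝓡 n) ∞ N) (hpe : p.1 ∈ e.source) (a : Fin n) :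
    frameH F e a p =
      (coordEquiv he hpe).symm (ex a - ∑ b, nonlin F e b a (coord e p) • ey b) :=
  mpullback_coord_apply he hpe _

lemma sum_smul_frameV (he : e ∈ IsManifold.maximalAtlas (𝓡 n) ∞ N) (hpe : p.1 ∈ e.source)
    (u : Mod n) : ∑ a, u a • frameV e a p = (coordEquiv he hpe).symm (0, u) := by
  simp only [frameV_eq he hpe, ← map_smul, ← map_sum, sum_smul_ey]

lemma sum_smul_frameH (he : e ∈ IsManifold.maximalAtlas (𝓡 n) ∞ N) (hpe : p.1 ∈ e.source)
    (u : Mod n) : ∑ a, u a • frameH F e a p =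
      (coordEquiv he hpe).symm (u, - nonlinVec F e (coord e p) u) := by
  simp only [frameH_eq he hpe, ← map_smul, ← map_sum]
  congr 1
  simp only [smul_sub, Finset.sum_sub_distrib, sum_smul_ex, Finset.smul_sum, smul_smul]
  rw [Finset.sum_comm]
  simp only [← Finset.sum_smul]
  have h := sum_smul_ey (nonlinVec F e (coord e p) u)
  have h' : ∑ b, (∑ a, u a * nonlin F e b a (coord e p)) • ey b =
      ((0, nonlinVec F e (coord e p) u) : Mod n × Mod n) := by
    rw [← h]
    refine Finset.sum_congr rfl fun b _ ↦ ?_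
    congr 1
    exact Finset.sum_congr rfl fun a _ ↦ mul_comm _ _
  rw [h']
  simp

omit [IsManifold (𝓡 n) ∞ N] in
lemma base_mem_chart_source : p.1 ∈ (chart p).source := mem_chart_source (Mod n) p.1

lemma chart_mem_maximalAtlas : chart p ∈ IsManifold.maximalAtlas (𝓡 n) ∞ N :=
  IsManifold.chart_mem_maximalAtlas p.1

/-- The vertical projector in an arbitrary chart. -/
lemma projV_eq (hF : IsFinsler F) (he : e ∈ IsManifold.maximalAtlas (𝓡 n) ∞ N)
    (hp : p ∈ slit n N) (hpe : p.1 ∈ e.source)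
    (X : ∀ p : TangentBundle (𝓡 n) N, TangentSpace (𝓡 n).tangent p) :
    projV F X p = (coordEquiv he hpe).symm (0, vertPart F e p (X p)) := by
  have hc := chart_mem_maximalAtlas (p := p)
  have hpc := base_mem_chart_source (p := p)
  have h1 : projV F X p = (coordEquiv hc hpc).symm (0, vertPart F (chart p) p (X p)) :=
    sum_smul_frameV hc hpc (vertPart F (chart p) p (X p))
  rw [h1, ContinuousLinearEquiv.symm_apply_eq, coordEquiv_apply, dcoord_eq he hc hp hpe hpc,
    dcoord_symm_apply, tanMapDeriv_apply, vertPart_trans hF he hc hp hpe hpc]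
  simp

/-- The horizontal projector in an arbitrary chart. -/
lemma projH_eq (hF : IsFinsler F) (he : e ∈ IsManifold.maximalAtlas (𝓡 n) ∞ N)
    (hp : p ∈ slit n N) (hpe : p.1 ∈ e.source)
    (X : ∀ p : TangentBundle (𝓡 n) N, TangentSpace (𝓡 n).tangent p) :
    projH F X p = (coordEquiv he hpe).symm ((dcoord e p (X p)).1,
      - nonlinVec F e (coord e p) (dcoord e p (X p)).1) := by
  have hc := chart_mem_maximalAtlas (p := p)
  have hpc := base_mem_chart_source (p := p)
  have h1 : projH F X p = (coordEquiv hc hpc).symm ((dcoord (chart p) p (X p)).1,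
      - nonlinVec F (chart p) (coord (chart p) p) (dcoord (chart p) p (X p)).1) :=
    sum_smul_frameH hc hpc (dcoord (chart p) p (X p)).1
  rw [h1, ContinuousLinearEquiv.symm_apply_eq, coordEquiv_apply,
    dcoord_fst_trans he hc hp hpe hpc (X p), dcoord_eq he hc hp hpe hpc, dcoord_symm_apply,
    tanMapDeriv_apply, coord_eq_tanMap he hc hpe hpc,
    nonlinVec_trans hF he hc (coord_mem_overlap he hp hpe hpc), map_neg]
  refine Prod.ext rfl ?_
  simp only
  abel

/-- The Sasaki–Finsler metric in an arbitrary chart. -/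
lemma sasaki_eq (hF : IsFinsler F) (he : e ∈ IsManifold.maximalAtlas (𝓡 n) ∞ N)
    (hp : p ∈ slit n N) (hpe : p.1 ∈ e.source) (v w : TangentSpace (𝓡 n).tangent p) :
    sasaki F p v w = ∑ a, ∑ b, gMat F e (coord e p) a b *
      ((dcoord e p v).1 a * (dcoord e p w).1 b + vertPart F e p v a * vertPart F e p w b) := by
  have hc := chart_mem_maximalAtlas (p := p)
  have hpc := base_mem_chart_source (p := p)
  have hz := coord_mem_slitDom he hp hpe
  have hz' := coord_mem_slitDom hc hp hpc
  have ho := coord_mem_overlap he hp hpe hpc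
  have h1 : sasaki F p v w = ∑ a, ∑ b, gMat F (chart p) (coord (chart p) p) a b *
      ((dcoord (chart p) p v).1 a * (dcoord (chart p) p w).1 b +
        vertPart F (chart p) p v a * vertPart F (chart p) p w b) := rfl
  rw [h1]
  simp only [mul_add, Finset.sum_add_distrib]
  rw [sum_gMat hF he hz, sum_gMat hF he hz, sum_gMat hF hc hz', sum_gMat hF hc hz',
    coord_eq_tanMap he hc hpe hpc]
  simp only [dcoord_fst_trans he hc hp hpe hpc, vertPart_trans hF he hc hp hpe hpc]
  rw [fderiv_fderiv_FSq_trans hF he hc ho, fderiv_fderiv_FSq_trans hF he hc ho]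

end Invariance

/-! ### Vector fields, brackets and the metric in induced coordinates -/

section LocalExpressions

variable {n : ℕ} {N : Type*} [TopologicalSpace N] [ChartedSpace (Mod n) N]
  [IsManifold (𝓡 n) ∞ N] {F : TangentBundle (𝓡 n) N → ℝ}
  {e : OpenPartialHomeomorph N (Mod n)} {p : TangentBundle (𝓡 n) N}

/-- The expression of the vector field `X` of `TN` in the coordinates induced by `e`. -/
def localRep (e : OpenPartialHomeomorph N (Mod n))
    (X : ∀ p : TangentBundle (𝓡 n) N, TangentSpace (𝓡 n).tangent p) (z : Mod n × Mod n) :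
    Mod n × Mod n :=
  dcoord e (param e z) (X (param e z))

lemma localRep_coord (he : e ∈ IsManifold.maximalAtlas (𝓡 n) ∞ N) (hpe : p.1 ∈ e.source)
    (X : ∀ p : TangentBundle (𝓡 n) N, TangentSpace (𝓡 n).tangent p) :
    localRep e X (coord e p) = dcoord e p (X p) := by
  rw [localRep, param_coord he hpe]

lemma mpullback_param_apply (he : e ∈ IsManifold.maximalAtlas (𝓡 n) ∞ N) {z : Mod n × Mod n}
    (hz : z.1 ∈ e.target) (X : ∀ p : TangentBundle (𝓡 n) N, TangentSpace (𝓡 n).tangent p) :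
    VectorField.mpullback 𝓘(ℝ, Mod n × Mod n) (𝓡 n).tangent (param e) X z = localRep e X z := by
  rw [VectorField.mpullback_apply]
  have hs : z ∈ (coordHomeo e he).target := ⟨hz, mem_univ _⟩
  exact congrFun (congrArg _ (ContinuousLinearMap.inverse_equiv
    ((mdifferentiable_coordHomeo he).symm.mfderiv (x := z) hs))) _

lemma mpullback_param_eventuallyEq (he : e ∈ IsManifold.maximalAtlas (𝓡 n) ∞ N)
    (hpe : p.1 ∈ e.source) (X : ∀ p : TangentBundle (𝓡 n) N, TangentSpace (𝓡 n).tangent p) :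
    localRep e X =ᶠ[nhds (coord e p)]
      VectorField.mpullback 𝓘(ℝ, Mod n × Mod n) (𝓡 n).tangent (param e) X := by
  filter_upwards [(coordHomeo e he).open_target.mem_nhds ((coordHomeo e he).map_source hpe)]
    with z hz
  exact (mpullback_param_apply he hz.1 X).symm

lemma mdifferentiableAt_vectorSpace_iff {X : Mod n × Mod n → Mod n × Mod n} {z : Mod n × Mod n} :
    MDifferentiableAt 𝓘(ℝ, Mod n × Mod n) 𝓘(ℝ, Mod n × Mod n).tangent
      (fun u ↦ (⟨u, X u⟩ : TangentBundle 𝓘(ℝ, Mod n × Mod n) (Mod n × Mod n))) z ↔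
      DifferentiableAt ℝ X z := by
  constructor
  · intro h
    have h' := ((contMDiff_snd_tangentBundle_modelSpace (𝕜 := ℝ) (n := 1) (Mod n × Mod n)
      𝓘(ℝ, Mod n × Mod n)).mdifferentiableAt one_ne_zero
      (x := ⟨z, X z⟩)).comp z h
    exact h'.differentiableAt
  · intro h
    rw [mdifferentiableAt_totalSpace]
    exact ⟨mdifferentiableAt_id, by simpa using! h.mdifferentiableAt⟩

lemma differentiableAt_localRep (he : e ∈ IsManifold.maximalAtlas (𝓡 n) ∞ N)
    (hpe : p.1 ∈ e.source) {X : ∀ p : TangentBundle (𝓡 n) N, TangentSpace (𝓡 n).tangent p}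
    (hX : MDiffAt (T% X) p) : DifferentiableAt ℝ (localRep e X) (coord e p) := by
  rw [← param_coord he hpe] at hX
  have h := hX.mpullback_vectorField (contMDiffAt_param he (e.map_source hpe))
    (isInvertible_mfderiv_param he hpe) (by norm_cast)
  exact (mdifferentiableAt_vectorSpace_iff.1 h).congr_of_eventuallyEq
    (mpullback_param_eventuallyEq he hpe X)

lemma mlieBracket_modelSpace (X Y : ∀ z : Mod n × Mod n, TangentSpace 𝓘(ℝ, Mod n × Mod n) z)
    (z : Mod n × Mod n) : VectorField.mlieBracket 𝓘(ℝ, Mod n × Mod n) X Y z =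
      VectorField.lieBracket ℝ X Y z := by
  rw [← VectorField.mlieBracketWithin_univ, VectorField.mlieBracketWithin_eq_lieBracketWithin]
  exact congrFun VectorField.lieBracketWithin_univ z

lemma dcoord_mlieBracket (he : e ∈ IsManifold.maximalAtlas (𝓡 n) ∞ N)
    (hpe : p.1 ∈ e.source) {X Y : ∀ p : TangentBundle (𝓡 n) N, TangentSpace (𝓡 n).tangent p}
    (hX : MDiffAt (T% X) p) (hY : MDiffAt (T% Y) p) :
    dcoord e p (VectorField.mlieBracket (𝓡 n).tangent X Y p) =
      fderiv ℝ (localRep e Y) (coord e p) (dcoord e p (X p)) -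
        fderiv ℝ (localRep e X) (coord e p) (dcoord e p (Y p)) := by
  rw [← localRep_coord he hpe (VectorField.mlieBracket (𝓡 n).tangent X Y),
    ← mpullback_param_apply he (e.map_source hpe)]
  rw [← param_coord he hpe] at hX hY
  have h2 : minSmoothness ℝ 2 ≤ ∞ := by
    rw [minSmoothness_of_isRCLikeNormedField]
    norm_cast
  have : IsManifold (𝓡 n).tangent (minSmoothness ℝ 2) (TangentBundle (𝓡 n) N) :=
    IsManifold.of_le (n := ∞) h2
  rw [VectorField.mpullback_mlieBracket hX hY (contMDiffAt_param he (e.map_source hpe))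
    h2, ← (mpullback_param_eventuallyEq he hpe X).mlieBracket_vectorField_eq
      (mpullback_param_eventuallyEq he hpe Y), ← localRep_coord he hpe X,
      ← localRep_coord he hpe Y]
  exact mlieBracket_modelSpace _ _ _

/-- The directional derivative of a function given in induced coordinates. -/
lemma dirDeriv_eq (he : e ∈ IsManifold.maximalAtlas (𝓡 n) ∞ N) (hpe : p.1 ∈ e.source)
    {f : TangentBundle (𝓡 n) N → ℝ} {h : Mod n × Mod n → ℝ} (hf : f =ᶠ[nhds p] h ∘ coord e)
    (hh : DifferentiableAt ℝ h (coord e p)) (v : TangentSpace (𝓡 n).tangent p) :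
    dirDeriv f p v = fderiv ℝ h (coord e p) (dcoord e p v) := by
  have h3 := (contMDiffAt_coord he hpe).mdifferentiableAt (by simp)
  have h4 := (hh.hasFDerivAt.hasMFDerivAt.comp p h3.hasMFDerivAt).congr_of_eventuallyEq hf
  exact DFunLike.congr_fun h4.mfderiv v

/-- The 1-form `δy^a` in coordinates. -/
def coframeVForm (F : TangentBundle (𝓡 n) N → ℝ) (e : OpenPartialHomeomorph N (Mod n)) (a : Fin n)
    (z : Mod n × Mod n) : Mod n × Mod n →L[ℝ] ℝ :=
  (EuclideanSpace.proj a).comp (.snd ℝ (Mod n) (Mod n)) +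
    ∑ b, nonlin F e a b z • (EuclideanSpace.proj b).comp (.fst ℝ (Mod n) (Mod n))

/-- The 1-form `dx^a` in coordinates. -/
def coframeHForm (a : Fin n) : Mod n × Mod n →L[ℝ] ℝ :=
  (EuclideanSpace.proj a).comp (.fst ℝ (Mod n) (Mod n))

/-- The Sasaki–Finsler metric in coordinates, as a bilinear form. -/
def metricForm (F : TangentBundle (𝓡 n) N → ℝ) (e : OpenPartialHomeomorph N (Mod n))
    (z : Mod n × Mod n) : Mod n × Mod n →L[ℝ] Mod n × Mod n →L[ℝ] ℝ :=
  ∑ a, ∑ b, gMat F e z a b • ((coframeHForm a).smulRight (coframeHForm b) +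
    (coframeVForm F e a z).smulRight (coframeVForm F e b z))

omit [IsManifold (𝓡 n) ∞ N] in
lemma coframeVForm_apply (a : Fin n) (z u : Mod n × Mod n) :
    coframeVForm F e a z u = u.2 a + ∑ b, nonlin F e a b z * u.1 b := by
  simp [coframeVForm, sum_apply]

omit [IsManifold (𝓡 n) ∞ N] in
lemma metricForm_apply (z u w : Mod n × Mod n) :
    metricForm F e z u w = ∑ a, ∑ b, gMat F e z a b * (u.1 a * w.1 b +
      coframeVForm F e a z u * coframeVForm F e b z w) := by
  simp [metricForm, coframeHForm, sum_apply, mul_add]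

lemma sasaki_eq_metricForm (hF : IsFinsler F) (he : e ∈ IsManifold.maximalAtlas (𝓡 n) ∞ N)
    (hp : p ∈ slit n N) (hpe : p.1 ∈ e.source) (v w : TangentSpace (𝓡 n).tangent p) :
    sasaki F p v w = metricForm F e (coord e p) (dcoord e p v) (dcoord e p w) := by
  simp only [sasaki_eq hF he hp hpe, metricForm_apply, coframeVForm_apply]
  rfl

lemma metricForm_symm (hF : IsFinsler F) (he : e ∈ IsManifold.maximalAtlas (𝓡 n) ∞ N)
    {z : Mod n × Mod n} (hz : z ∈ slitDom e) (u w : Mod n × Mod n) :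
    metricForm F e z u w = metricForm F e z w u := by
  rw [metricForm_apply, metricForm_apply, Finset.sum_comm]
  refine Finset.sum_congr rfl fun a _ ↦ Finset.sum_congr rfl fun b _ ↦ ?_
  rw [gMat_symm hF he hz]
  ring

lemma differentiableAt_metricForm (hF : IsFinsler F)
    (he : e ∈ IsManifold.maximalAtlas (𝓡 n) ∞ N) {z : Mod n × Mod n} (hz : z ∈ slitDom e) :
    DifferentiableAt ℝ (metricForm F e) z := by
  have h : ContDiffOn ℝ ∞ (metricForm F e) (slitDom e) := by
    refine contDiffOn_clm_apply.2 fun u ↦ contDiffOn_clm_apply.2 fun w ↦ ?_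
    have hc : ∀ a v, ContDiffOn ℝ ∞ (fun z ↦ coframeVForm F e a z v) (slitDom e) := fun a v ↦ by
      simp only [coframeVForm_apply]
      exact contDiffOn_const.add (ContDiffOn.sum fun b _ ↦
        (contDiffOn_nonlin hF he a b).mul contDiffOn_const)
    simp only [metricForm_apply]
    exact ContDiffOn.sum fun a _ ↦ ContDiffOn.sum fun b _ ↦
      (contDiffOn_gMat hF he a b).mul (contDiffOn_const.add ((hc a u).mul (hc b w)))
  exact (h.contDiffAt (isOpen_slitDom.mem_nhds hz)).differentiableAt (by simp)

lemma metricForm_nondegenerate (hF : IsFinsler F)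
    (he : e ∈ IsManifold.maximalAtlas (𝓡 n) ∞ N) {z : Mod n × Mod n} (hz : z ∈ slitDom e)
    {u : Mod n × Mod n} (hu : ∀ w, metricForm F e z u w = 0) : u = 0 := by
  have h := hu u
  set v : Mod n := WithLp.toLp 2 fun a ↦ coframeVForm F e a z u with hv
  have h1 : metricForm F e z u u = ∑ a, ∑ b, gMat F e z a b * (u.1 a * u.1 b) +
      ∑ a, ∑ b, gMat F e z a b * (v a * v b) := by
    simp only [metricForm_apply, mul_add, Finset.sum_add_distrib]
    rfl
  have hpos : ∀ x : Mod n, 0 ≤ ∑ a, ∑ b, gMat F e z a b * (x a * x b) := fun x ↦ by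
    rcases eq_or_ne x 0 with rfl | hx
    · simp
    · exact (sum_gMat_pos hF he hz hx).le
  have h2 : u.1 = 0 := by
    by_contra hne
    linarith [sum_gMat_pos hF he hz hne, hpos v]
  have h3 : v = 0 := by
    by_contra hne
    linarith [sum_gMat_pos hF he hz hne, hpos u.1]
  refine Prod.ext h2 ?_
  ext a
  have h4 : v a = u.2 a := by simp [hv, coframeVForm_apply, h2]
  rw [← h4, h3]
  rfl

/-! ### The adapted frame and its brackets -/

lemma differentiableAt_nonlin (hF : IsFinsler F) (he : e ∈ IsManifold.maximalAtlas (𝓡 n) ∞ N)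
    {z : Mod n × Mod n} (hz : z ∈ slitDom e) (a b : Fin n) :
    DifferentiableAt ℝ (nonlin F e a b) z :=
  ((contDiffOn_nonlin hF he a b).contDiffAt (isOpen_slitDom.mem_nhds hz)).differentiableAt (by simp)

lemma hasFDerivAt_coordFieldH (hF : IsFinsler F) (he : e ∈ IsManifold.maximalAtlas (𝓡 n) ∞ N)
    {z : Mod n × Mod n} (hz : z ∈ slitDom e) (a : Fin n) :
    HasFDerivAt (fun u ↦ (coordFieldH F e a u : Mod n × Mod n))
      (-∑ b, (fderiv ℝ (nonlin F e b a) z).smulRight (ey b)) z := by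
  have h := (hasFDerivAt_const (ex a : Mod n × Mod n) z).sub (HasFDerivAt.fun_sum
    (u := Finset.univ) fun b _ ↦
      (differentiableAt_nonlin hF he hz b a).hasFDerivAt.smul_const (ey b : Mod n × Mod n))
  rwa [zero_sub] at h

lemma mdifferentiableAt_frameV (he : e ∈ IsManifold.maximalAtlas (𝓡 n) ∞ N)
    (hpe : p.1 ∈ e.source) (a : Fin n) : MDiffAt (T% (frameV (N := N) e a)) p :=
  MDifferentiableAt.mpullback_vectorField (n := ∞)
    (mdifferentiableAt_vectorSpace_iff.2 (differentiableAt_const _))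
    (contMDiffAt_coord he hpe) (isInvertible_mfderiv_coord he hpe) (by norm_cast)

lemma mdifferentiableAt_frameH (hF : IsFinsler F) (he : e ∈ IsManifold.maximalAtlas (𝓡 n) ∞ N)
    (hp : p ∈ slit n N) (hpe : p.1 ∈ e.source) (a : Fin n) : MDiffAt (T% (frameH F e a)) p :=
  MDifferentiableAt.mpullback_vectorField (n := ∞)
    (mdifferentiableAt_vectorSpace_iff.2
      (hasFDerivAt_coordFieldH hF he (coord_mem_slitDom he hp hpe) a).differentiableAt)
    (contMDiffAt_coord he hpe) (isInvertible_mfderiv_coord he hpe) (by norm_cast)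

lemma dcoord_frameV (he : e ∈ IsManifold.maximalAtlas (𝓡 n) ∞ N) (hpe : p.1 ∈ e.source)
    (a : Fin n) : dcoord e p (frameV e a p) = ey a := by
  rw [frameV_eq he hpe, dcoord_symm_apply]

lemma dcoord_frameH (he : e ∈ IsManifold.maximalAtlas (𝓡 n) ∞ N) (hpe : p.1 ∈ e.source)
    (a : Fin n) : dcoord e p (frameH F e a p) =
      ex a - ∑ b, nonlin F e b a (coord e p) • ey b := by
  rw [frameH_eq he hpe, dcoord_symm_apply]

lemma localRep_frameV (he : e ∈ IsManifold.maximalAtlas (𝓡 n) ∞ N) (hpe : p.1 ∈ e.source)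
    (a : Fin n) : localRep e (frameV (N := N) e a) =ᶠ[nhds (coord e p)] fun _ ↦ ey a := by
  filter_upwards [(coordHomeo e he).open_target.mem_nhds ((coordHomeo e he).map_source hpe)]
    with z hz
  exact dcoord_frameV he (e.map_target hz.1) a

lemma localRep_frameH (he : e ∈ IsManifold.maximalAtlas (𝓡 n) ∞ N) (hpe : p.1 ∈ e.source)
    (a : Fin n) : localRep e (frameH F e a) =ᶠ[nhds (coord e p)] coordFieldH F e a := by
  filter_upwards [(coordHomeo e he).open_target.mem_nhds ((coordHomeo e he).map_source hpe)]
    with z hz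
  rw [localRep, dcoord_frameH he (e.map_target hz.1) a, coord_param he hz.1]
  rfl

lemma fderiv_localRep_frameV (he : e ∈ IsManifold.maximalAtlas (𝓡 n) ∞ N) (hpe : p.1 ∈ e.source)
    (a : Fin n) : fderiv ℝ (localRep e (frameV (N := N) e a)) (coord e p) = 0 := by
  rw [(localRep_frameV he hpe a).fderiv_eq]
  exact fderiv_const_apply _

lemma fderiv_localRep_frameH (hF : IsFinsler F) (he : e ∈ IsManifold.maximalAtlas (𝓡 n) ∞ N)
    (hp : p ∈ slit n N) (hpe : p.1 ∈ e.source) (a : Fin n) :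
    fderiv ℝ (localRep e (frameH F e a)) (coord e p) =
      -∑ b, (fderiv ℝ (nonlin F e b a) (coord e p)).smulRight (ey b) := by
  rw [(localRep_frameH he hpe a).fderiv_eq]
  exact (hasFDerivAt_coordFieldH hF he (coord_mem_slitDom he hp hpe) a).fderiv

lemma fderiv_localRep_frameH_apply_fst (hF : IsFinsler F)
    (he : e ∈ IsManifold.maximalAtlas (𝓡 n) ∞ N)
    (hp : p ∈ slit n N) (hpe : p.1 ∈ e.source) (a : Fin n) (u : Mod n × Mod n) :
    (fderiv ℝ (localRep e (frameH F e a)) (coord e p) u).1 = 0 := by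
  simp [fderiv_localRep_frameH hF he hp hpe, sum_apply, Prod.fst_sum, ey]

lemma mlieBracket_frameV_frameV (he : e ∈ IsManifold.maximalAtlas (𝓡 n) ∞ N)
    (hpe : p.1 ∈ e.source) (a b : Fin n) :
    VectorField.mlieBracket (𝓡 n).tangent (frameV (N := N) e b) (frameV e a) p = 0 := by
  apply (coordEquiv he hpe).injective
  rw [coordEquiv_apply, dcoord_mlieBracket he hpe (mdifferentiableAt_frameV he hpe b)
    (mdifferentiableAt_frameV he hpe a), fderiv_localRep_frameV he hpe,
    fderiv_localRep_frameV he hpe, map_zero]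
  simp

lemma dcoord_mlieBracket_frameH_frameV (hF : IsFinsler F)
    (he : e ∈ IsManifold.maximalAtlas (𝓡 n) ∞ N)
    (hp : p ∈ slit n N) (hpe : p.1 ∈ e.source) (a b : Fin n) :
    dcoord e p (VectorField.mlieBracket (𝓡 n).tangent (frameH F e b) (frameV e a) p) =
      ∑ c, dy a (nonlin F e c b) (coord e p) • ey c := by
  rw [dcoord_mlieBracket he hpe (mdifferentiableAt_frameH hF he hp hpe b)
    (mdifferentiableAt_frameV he hpe a), fderiv_localRep_frameV he hpe,
    fderiv_localRep_frameH hF he hp hpe, dcoord_frameV he hpe]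
  simp [sum_apply, dy]

lemma dcoord_mlieBracket_frameV_frameH_fst (hF : IsFinsler F)
    (he : e ∈ IsManifold.maximalAtlas (𝓡 n) ∞ N)
    (hp : p ∈ slit n N) (hpe : p.1 ∈ e.source) (a b : Fin n) :
    (dcoord e p (VectorField.mlieBracket (𝓡 n).tangent (frameV e b) (frameH F e a) p)).1 = 0 := by
  rw [dcoord_mlieBracket he hpe (mdifferentiableAt_frameV he hpe b)
    (mdifferentiableAt_frameH hF he hp hpe a), fderiv_localRep_frameV he hpe, zero_apply, sub_zero,
    fderiv_localRep_frameH_apply_fst hF he hp hpe]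

lemma dcoord_mlieBracket_frameH_frameH_fst (hF : IsFinsler F)
    (he : e ∈ IsManifold.maximalAtlas (𝓡 n) ∞ N)
    (hp : p ∈ slit n N) (hpe : p.1 ∈ e.source) (a b : Fin n) :
    (dcoord e p (VectorField.mlieBracket (𝓡 n).tangent (frameH F e b) (frameH F e a) p)).1 = 0 := by
  rw [dcoord_mlieBracket he hpe (mdifferentiableAt_frameH hF he hp hpe b)
    (mdifferentiableAt_frameH hF he hp hpe a), Prod.fst_sub,
    fderiv_localRep_frameH_apply_fst hF he hp hpe, fderiv_localRep_frameH_apply_fst hF he hp hpe,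
    sub_zero]

end LocalExpressions

/-! ### Existence of a Weyl connection -/

section Christoffel

variable {V : Type*} [NormedAddCommGroup V] [NormedSpace ℝ V] [FiniteDimensional ℝ V]

-- The additive structure on trilinear maps is found only at a larger search depth.
set_option maxSynthPendingDepth 3 in
/-- Christoffel symbols: for a nondegenerate bilinear form `B` and a trilinear form `P` which is
symmetric in its last two arguments there is a symmetric bilinear map `Γ` with
`B(Γ(u, v), w) + B(v, Γ(u, w)) = P(u, v, w)`. -/
lemma exists_christoffel (B : V →L[ℝ] V →L[ℝ] ℝ) (hB : ∀ u, (∀ w, B u w = 0) → u = 0)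
    (hBs : ∀ u w, B u w = B w u)
    (P : V →L[ℝ] V →L[ℝ] V →L[ℝ] ℝ) (hP : ∀ u v w, P u v w = P u w v) :
    ∃ Γ : V →L[ℝ] V →L[ℝ] V, (∀ u v, Γ u v = Γ v u) ∧
      ∀ u v w, B (Γ u v) w + B v (Γ u w) = P u v w := by
  have hinj : Function.Injective (B : V →ₗ[ℝ] V →L[ℝ] ℝ) := by
    rw [injective_iff_map_eq_zero]
    exact fun u hu ↦ hB u fun w ↦ by
      have := DFunLike.congr_fun (show B u = 0 from hu) w
      simpa using this
  have hdim : Module.finrank ℝ V = Module.finrank ℝ (V →L[ℝ] ℝ) := by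
    rw [← (LinearMap.toContinuousLinearMap (𝕜 := ℝ) (E := V) (F' := ℝ)).finrank_eq]
    exact Subspace.dual_finrank_eq.symm
  let Φ : V ≃L[ℝ] (V →L[ℝ] ℝ) :=
    (LinearMap.linearEquivOfInjective (B : V →ₗ[ℝ] V →L[ℝ] ℝ) hinj hdim).toContinuousLinearEquiv
  have hΦ : ∀ (α : V →L[ℝ] ℝ) w, B (Φ.symm α) w = α w := fun α w ↦
    DFunLike.congr_fun (Φ.apply_symm_apply α) w
  -- The Koszul formula.
  let R : V →L[ℝ] V →L[ℝ] V →L[ℝ] ℝ :=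
    (ContinuousLinearMap.flipₗᵢ ℝ V V ℝ : (V →L[ℝ] V →L[ℝ] ℝ) →L[ℝ] V →L[ℝ] V →L[ℝ] ℝ).comp P.flip
  have hR : ∀ u v w, R u v w = P w u v := fun u v w ↦ rfl
  let κ : V →L[ℝ] V →L[ℝ] V →L[ℝ] ℝ := (1 / 2 : ℝ) • (P + P.flip - R)
  have hκ : ∀ u v w, κ u v w = 1 / 2 * (P u v w + P v u w - P w u v) := fun u v w ↦ rfl
  refine ⟨((Φ.symm : (V →L[ℝ] ℝ) →L[ℝ] V).postcomp V).comp κ, fun u v ↦ ?_, fun u v w ↦ ?_⟩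
  · have : κ u v = κ v u := by
      ext w
      rw [hκ, hκ, hP w u v]
      ring
    exact congrArg Φ.symm this
  · change B (Φ.symm (κ u v)) w + B v (Φ.symm (κ u w)) = P u v w
    rw [hBs v, hΦ, hΦ, hκ, hκ, hP u w v, hP w u v, hP v u w]
    ring

end Christoffel

section Existence

variable {n : ℕ} {N : Type*} [TopologicalSpace N] [ChartedSpace (Mod n) N]
  [IsManifold (𝓡 n) ∞ N] {F : TangentBundle (𝓡 n) N → ℝ}
  {e : OpenPartialHomeomorph N (Mod n)} {p : TangentBundle (𝓡 n) N}

/-- `Γ` is a choice of Christoffel symbols at `p` of a Weyl connection, in the coordinates induced by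
the preferred chart: it is symmetric (no torsion) and satisfies `∇G + W ⊗ G = 0`, where `G` is read
as the form-valued map `metricForm`. -/
def IsWeylChristoffel (F : TangentBundle (𝓡 n) N → ℝ)
    (p : TangentBundle (𝓡 n) N) (W : TangentSpace (𝓡 n).tangent p →L[ℝ] ℝ)
    (Γ : Mod n × Mod n →L[ℝ] Mod n × Mod n →L[ℝ] Mod n × Mod n) : Prop :=
  (∀ u v, Γ u v = Γ v u) ∧ ∀ u v w,
    metricForm F (chart p) (coord (chart p) p) (Γ u v) w +
      metricForm F (chart p) (coord (chart p) p) v (Γ u w) =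
    fderiv ℝ (metricForm F (chart p)) (coord (chart p) p) u v w +
      W ((coordEquiv chart_mem_maximalAtlas base_mem_chart_source).symm u) *
        metricForm F (chart p) (coord (chart p) p) v w

lemma exists_isWeylChristoffel (hF : IsFinsler F) (hp : p ∈ slit n N)
    (W : TangentSpace (𝓡 n).tangent p →L[ℝ] ℝ) : ∃ Γ, IsWeylChristoffel F p W Γ := by
  have he := chart_mem_maximalAtlas (p := p)
  have hpe := base_mem_chart_source (p := p)
  have hz := coord_mem_slitDom he hp hpe
  set B := metricForm F (chart p) with hBdef
  set z := coord (chart p) p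
  have hB := differentiableAt_metricForm hF he hz
  let α : Mod n × Mod n →L[ℝ] ℝ :=
    W.comp ((coordEquiv he hpe).symm : Mod n × Mod n →L[ℝ] TangentSpace (𝓡 n).tangent p)
  have hDs : ∀ u v w, fderiv ℝ B z u v w = fderiv ℝ B z u w v := fun u v w ↦ by
    have h1 : ∀ v w, HasFDerivAt (fun y ↦ B y v w)
        (((fderiv ℝ B z).flip v).flip w) z := fun v w ↦ by
      simpa using (hB.hasFDerivAt.clm_apply (hasFDerivAt_const v z)).clm_apply
        (hasFDerivAt_const w z)
    have h2 : (fun y ↦ B y v w) =ᶠ[nhds z] fun y ↦ B y w v := by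
      filter_upwards [isOpen_slitDom.mem_nhds hz] with y hy using metricForm_symm hF he hy v w
    exact DFunLike.congr_fun ((h1 v w).unique ((h1 w v).congr_of_eventuallyEq h2)) u
  exact exists_christoffel (B z) (fun u hu ↦ metricForm_nondegenerate hF he hz hu)
    (metricForm_symm hF he hz) (fderiv ℝ B z + α.smulRight (B z)) fun u v w ↦ by
      have h1 := hDs u v w
      have h2 := metricForm_symm hF he hz v w
      simp only [add_apply, ContinuousLinearMap.smulRight_apply, smul_apply, h1]
      rw [show B z v w = B z w v from h2]

open Classical in
/-- A Weyl connection: over the preferred chart at `p` it is the sum of the flat connection of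
the chart and a Christoffel term. Off `TN⁰` its value is irrelevant, and taken to be zero. -/
def weylConnection (hF : IsFinsler F)
    (W : ∀ p : TangentBundle (𝓡 n) N, TangentSpace (𝓡 n).tangent p →L[ℝ] ℝ)
    (Y : ∀ p : TangentBundle (𝓡 n) N, TangentSpace (𝓡 n).tangent p)
    (p : TangentBundle (𝓡 n) N) :
    TangentSpace (𝓡 n).tangent p →L[ℝ] TangentSpace (𝓡 n).tangent p :=
  if hp : p ∈ slit n N then
    let E := coordEquiv (p := p) chart_mem_maximalAtlas base_mem_chart_source
    (E.symm : Mod n × Mod n →L[ℝ] TangentSpace (𝓡 n).tangent p).comp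
      ((fderiv ℝ (localRep (chart p) Y) (coord (chart p) p) +
        (exists_isWeylChristoffel hF hp (W p)).choose.flip (dcoord (chart p) p (Y p))).comp
      (E : TangentSpace (𝓡 n).tangent p →L[ℝ] Mod n × Mod n))
  else 0

variable {W : ∀ p : TangentBundle (𝓡 n) N, TangentSpace (𝓡 n).tangent p →L[ℝ] ℝ}

lemma weylConnection_spec (hF : IsFinsler F) (hp : p ∈ slit n N) :
    ∃ Γ, IsWeylChristoffel F p (W p) Γ ∧ ∀ Y v, dcoord (chart p) p (weylConnection hF W Y p v) =
      fderiv ℝ (localRep (chart p) Y) (coord (chart p) p) (dcoord (chart p) p v) +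
        Γ (dcoord (chart p) p v) (dcoord (chart p) p (Y p)) := by
  refine ⟨_, (exists_isWeylChristoffel hF hp (W p)).choose_spec, fun Y v ↦ ?_⟩
  rw [weylConnection, dif_pos hp]
  exact dcoord_symm_apply chart_mem_maximalAtlas base_mem_chart_source _

lemma dcoord_add (v w : TangentSpace (𝓡 n).tangent p) :
    dcoord e p (v + w) = dcoord e p v + dcoord e p w := map_add _ v w

lemma dcoord_smul (t : ℝ) (v : TangentSpace (𝓡 n).tangent p) :
    dcoord e p (t • v) = t • dcoord e p v := map_smul _ t v

lemma dcoord_sub (v w : TangentSpace (𝓡 n).tangent p) :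
    dcoord e p (v - w) = dcoord e p v - dcoord e p w := map_sub _ v w

lemma dcoord_injective (he : e ∈ IsManifold.maximalAtlas (𝓡 n) ∞ N) (hpe : p.1 ∈ e.source) :
    Function.Injective (dcoord e p) :=
  (coordEquiv he hpe).injective

lemma isWeylConnection_weylConnection (hF : IsFinsler F) :
    IsWeylConnection F W (weylConnection hF W) where
  isCovariantDerivativeOn :=
    { add := by
        intro σ σ' p hσ hσ' hp
        have he := chart_mem_maximalAtlas (p := p)
        have hpe := base_mem_chart_source (p := p)
        obtain ⟨Γ, -, h⟩ := weylConnection_spec (W := W) hF hp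
        ext v
        apply dcoord_injective he hpe
        have h1 : localRep (chart p) (σ + σ') = localRep (chart p) σ + localRep (chart p) σ' := by
          ext1 z
          exact dcoord_add _ _
        rw [h, add_apply, dcoord_add, h, h, h1,
          fderiv_add (differentiableAt_localRep he hpe hσ) (differentiableAt_localRep he hpe hσ'),
          Pi.add_apply, dcoord_add, map_add, add_apply]
        abel
      leibniz := by
        intro σ g p hσ hg hp
        have he := chart_mem_maximalAtlas (p := p)
        have hpe := base_mem_chart_source (p := p)
        obtain ⟨Γ, -, h⟩ := weylConnection_spec (W := W) hF hp
        ext v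
        apply dcoord_injective he hpe
        have h1 : localRep (chart p) (g • σ) =
            fun z ↦ (g ∘ param (chart p)) z • localRep (chart p) σ z := by
          ext1 z
          exact dcoord_smul _ _
        have hg' : MDiffAt g (param (chart p) (coord (chart p) p)) := by
          rwa [param_coord he hpe]
        have h2 : DifferentiableAt ℝ (g ∘ param (chart p)) (coord (chart p) p) :=
          (hg'.comp _ ((contMDiffAt_param he ((chart p).map_source hpe)).mdifferentiableAt
            (by simp))).differentiableAt
        have h3 : g =ᶠ[nhds p] (g ∘ param (chart p)) ∘ coord (chart p) := by
          filter_upwards [eventually_mem_slit_inter he hp hpe] with q hq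
          simp only [Function.comp, param_coord he hq.2]
        have h4 := dirDeriv_eq he hpe h3 h2 v
        rw [h, h1, fderiv_fun_smul h2 (differentiableAt_localRep he hpe hσ)]
        simp only [add_apply, smul_apply, ContinuousLinearMap.smulRight_apply, dcoord_add,
          dcoord_smul, h, Function.comp, param_coord he hpe, localRep_coord he hpe, Pi.smul_apply']
        rw [map_smul, smul_add]
        have h5 : (d% g p) v = fderiv ℝ (g ∘ param (chart p)) (coord (chart p) p)
          (dcoord (chart p) p v) := h4
        rw [h5]
        simp only [Function.comp_def]
        abel }
  torsion_free p hp X Y hX hY := by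
    have he := chart_mem_maximalAtlas (p := p)
    have hpe := base_mem_chart_source (p := p)
    obtain ⟨Γ, hΓ, h⟩ := weylConnection_spec (W := W) hF hp
    apply dcoord_injective he hpe
    rw [dcoord_sub, h, h, dcoord_mlieBracket he hpe hX hY, hΓ.1]
    abel
  compatible p hp X Y Z hX hY hZ := by
    have he := chart_mem_maximalAtlas (p := p)
    have hpe := base_mem_chart_source (p := p)
    obtain ⟨Γ, hΓ, h⟩ := weylConnection_spec (W := W) hF hp
    have hz := coord_mem_slitDom he hp hpe
    have hY' := differentiableAt_localRep he hpe hY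
    have hZ' := differentiableAt_localRep he hpe hZ
    have hB := differentiableAt_metricForm hF he hz
    have h1 := (hB.hasFDerivAt.clm_apply hY'.hasFDerivAt).clm_apply hZ'.hasFDerivAt
    have h2 : (fun q ↦ sasaki F q (Y q) (Z q)) =ᶠ[nhds p]
        (fun z ↦ metricForm F (chart p) z (localRep (chart p) Y z) (localRep (chart p) Z z)) ∘
          coord (chart p) := by
      filter_upwards [eventually_mem_slit_inter he hp hpe] with q hq
      simp only [Function.comp, localRep_coord he hq.2]
      exact sasaki_eq_metricForm hF he hq.1 hq.2 _ _
    rw [dirDeriv_eq he hpe h2 h1.differentiableAt, h1.fderiv]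
    simp only [sasaki_eq_metricForm hF he hp hpe, h, localRep_coord he hpe]
    have h3 := hΓ.2 (dcoord (chart p) p (X p)) (dcoord (chart p) p (Y p)) (dcoord (chart p) p (Z p))
    have h4 : (coordEquiv (p := p) chart_mem_maximalAtlas base_mem_chart_source).symm
        (dcoord (chart p) p (X p)) = X p := (coordEquiv he hpe).symm_apply_apply _
    rw [h4] at h3
    simp only [add_apply, ContinuousLinearMap.comp_apply, ContinuousLinearMap.flip_apply, map_add]
    linarith

end Existence

/-! ### Locality and the Koszul formula -/

section Vranceanu

variable {n : ℕ} {N : Type*} [TopologicalSpace N] [ChartedSpace (Mod n) N]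
  [IsManifold (𝓡 n) ∞ N] {F : TangentBundle (𝓡 n) N → ℝ}
  {e : OpenPartialHomeomorph N (Mod n)} {p : TangentBundle (𝓡 n) N}
  {W : ∀ p : TangentBundle (𝓡 n) N, TangentSpace (𝓡 n).tangent p →L[ℝ] ℝ}
  {D : (∀ p : TangentBundle (𝓡 n) N, TangentSpace (𝓡 n).tangent p) →
      ∀ p : TangentBundle (𝓡 n) N,
        TangentSpace (𝓡 n).tangent p →L[ℝ] TangentSpace (𝓡 n).tangent p}

open Classical in
/-- A linear connection is local: it depends only on the germ of the differentiated field. -/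
lemma covariantDerivative_congr
    (hD : IsCovariantDerivativeOn (I := (𝓡 n).tangent) (Mod n × Mod n) D (slit n N))
    (hp : p ∈ slit n N) {X Y : ∀ p : TangentBundle (𝓡 n) N, TangentSpace (𝓡 n).tangent p}
    (hX : MDiffAt (T% X) p) (hXY : X =ᶠ[nhds p] Y) : D X p = D Y p := by
  have hY : MDiffAt (T% Y) p := hX.congr_of_eventuallyEq (hXY.mono fun q hq ↦ by
    simp only [hq])
  -- The indicator function of the coincidence set serves as a cut-off function.
  let g : TangentBundle (𝓡 n) N → ℝ := fun q ↦ if X q = Y q then 1 else 0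
  have hg : g =ᶠ[nhds p] fun _ ↦ 1 := hXY.mono fun q hq ↦ if_pos hq
  have hg' : HasMFDerivAt (𝓡 n).tangent 𝓘(ℝ) g p 0 :=
    (hasMFDerivAt_const (1 : ℝ) p).congr_of_eventuallyEq hg
  have hgXY : g • X = g • Y := by
    funext q
    by_cases h : X q = Y q
    · simp [h]
    · simp [g, h]
  have h1 := hD.leibniz hX hg'.mdifferentiableAt hp
  have h2 := hD.leibniz hY hg'.mdifferentiableAt hp
  rw [hgXY, h2] at h1
  have h3 : g p = 1 := hg.self_of_nhds
  have h4 : d% g p = 0 := hg'.mfderiv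
  rw [h3, h4, one_smul, one_smul] at h1
  ext v
  simpa using (DFunLike.congr_fun h1 v).symm

lemma sasaki_symm (hF : IsFinsler F) (hp : p ∈ slit n N) (v w : TangentSpace (𝓡 n).tangent p) :
    sasaki F p v w = sasaki F p w v := by
  have he := chart_mem_maximalAtlas (p := p)
  have hpe := base_mem_chart_source (p := p)
  rw [sasaki_eq_metricForm hF he hp hpe, sasaki_eq_metricForm hF he hp hpe,
    metricForm_symm hF he (coord_mem_slitDom he hp hpe)]

lemma sasaki_sub_left (hF : IsFinsler F) (hp : p ∈ slit n N)
    (v v' w : TangentSpace (𝓡 n).tangent p) :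
    sasaki F p (v - v') w = sasaki F p v w - sasaki F p v' w := by
  have he := chart_mem_maximalAtlas (p := p)
  have hpe := base_mem_chart_source (p := p)
  simp only [sasaki_eq_metricForm hF he hp hpe, dcoord_sub, map_sub, sub_apply]

/-- The Koszul formula of a Weyl connection, for fields whose brackets are orthogonal to them. -/
lemma IsWeylConnection.koszul (hF : IsFinsler F) (hD : IsWeylConnection F W D)
    (hp : p ∈ slit n N) {X Y Z : ∀ p : TangentBundle (𝓡 n) N, TangentSpace (𝓡 n).tangent p}
    (hX : MDiffAt (T% X) p) (hY : MDiffAt (T% Y) p) (hZ : MDiffAt (T% Z) p)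
    (hXY : sasaki F p (VectorField.mlieBracket (𝓡 n).tangent X Y p) (Z p) = 0)
    (hYZ : sasaki F p (VectorField.mlieBracket (𝓡 n).tangent Y Z p) (X p) = 0)
    (hXZ : sasaki F p (VectorField.mlieBracket (𝓡 n).tangent X Z p) (Y p) = 0) :
    sasaki F p (D Y p (X p)) (Z p) = 1 / 2 *
      (dirDeriv (fun q ↦ sasaki F q (Y q) (Z q)) p (X p)
        + dirDeriv (fun q ↦ sasaki F q (Z q) (X q)) p (Y p)
        - dirDeriv (fun q ↦ sasaki F q (X q) (Y q)) p (Z p)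
        + W p (X p) * sasaki F p (Y p) (Z p) + W p (Y p) * sasaki F p (Z p) (X p)
        - W p (Z p) * sasaki F p (X p) (Y p)) := by
  rw [← hD.torsion_free p hp _ _ hX hY, sasaki_sub_left hF hp] at hXY
  rw [← hD.torsion_free p hp _ _ hY hZ, sasaki_sub_left hF hp] at hYZ
  rw [← hD.torsion_free p hp _ _ hX hZ, sasaki_sub_left hF hp] at hXZ
  have h1 := hD.compatible p hp X Y Z hX hY hZ
  have h2 := hD.compatible p hp Y Z X hY hZ hX
  have h3 := hD.compatible p hp Z X Y hZ hX hY
  rw [sasaki_symm hF hp (Y p) (D Z p (X p))] at h1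
  rw [sasaki_symm hF hp (Z p) (D X p (Y p))] at h2
  rw [sasaki_symm hF hp (X p) (D Y p (Z p))] at h3
  linarith

/-! ### The metric and the projectors in the adapted frame -/

omit [IsManifold (𝓡 n) ∞ N] in
lemma nonlinVec_zero (z : Mod n × Mod n) : nonlinVec F e z 0 = 0 := by
  ext a
  simp [nonlinVec]

omit [IsManifold (𝓡 n) ∞ N] in
lemma nonlinVec_single (z : Mod n × Mod n) (a : Fin n) :
    nonlinVec F e z (EuclideanSpace.single a 1) = WithLp.toLp 2 fun b ↦ nonlin F e b a z := by
  ext b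
  simp [nonlinVec]

lemma dcoord_frameH_eq (he : e ∈ IsManifold.maximalAtlas (𝓡 n) ∞ N) (hpe : p.1 ∈ e.source)
    (a : Fin n) : dcoord e p (frameH F e a p) = (EuclideanSpace.single a 1,
      - nonlinVec F e (coord e p) (EuclideanSpace.single a 1)) := by
  rw [dcoord_frameH he hpe, nonlinVec_single, show ∑ b, nonlin F e b a (coord e p) • ey b =
    ((0, WithLp.toLp 2 fun b ↦ nonlin F e b a (coord e p)) : Mod n × Mod n) from
      sum_smul_ey (WithLp.toLp 2 fun b ↦ nonlin F e b a (coord e p))]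
  simp [ex]

lemma vertPart_frameV (he : e ∈ IsManifold.maximalAtlas (𝓡 n) ∞ N) (hpe : p.1 ∈ e.source)
    (a : Fin n) : vertPart F e p (frameV e a p) = EuclideanSpace.single a 1 := by
  rw [vertPart_eq, dcoord_frameV he hpe, ey, nonlinVec_zero, add_zero]

lemma vertPart_frameH (he : e ∈ IsManifold.maximalAtlas (𝓡 n) ∞ N) (hpe : p.1 ∈ e.source)
    (a : Fin n) : vertPart F e p (frameH F e a p) = 0 := by
  rw [vertPart_eq, dcoord_frameH_eq he hpe, neg_add_cancel]

lemma projV_frameV (hF : IsFinsler F) (he : e ∈ IsManifold.maximalAtlas (𝓡 n) ∞ N)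
    (hp : p ∈ slit n N) (hpe : p.1 ∈ e.source) (a : Fin n) :
    projV F (frameV e a) =ᶠ[nhds p] frameV e a := by
  filter_upwards [eventually_mem_slit_inter he hp hpe] with q hq
  rw [projV_eq hF he hq.1 hq.2, vertPart_frameV he hq.2, frameV_eq he hq.2, ey]

lemma projH_frameV (hF : IsFinsler F) (he : e ∈ IsManifold.maximalAtlas (𝓡 n) ∞ N)
    (hp : p ∈ slit n N) (hpe : p.1 ∈ e.source) (a : Fin n) :
    projH F (frameV e a) =ᶠ[nhds p]
      (0 : ∀ q : TangentBundle (𝓡 n) N, TangentSpace (𝓡 n).tangent q) := by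
  filter_upwards [eventually_mem_slit_inter he hp hpe] with q hq
  rw [projH_eq hF he hq.1 hq.2, dcoord_frameV he hq.2, ey, nonlinVec_zero, neg_zero]
  exact map_zero _

lemma projV_frameH (hF : IsFinsler F) (he : e ∈ IsManifold.maximalAtlas (𝓡 n) ∞ N)
    (hp : p ∈ slit n N) (hpe : p.1 ∈ e.source) (a : Fin n) :
    projV F (frameH F e a) =ᶠ[nhds p]
      (0 : ∀ q : TangentBundle (𝓡 n) N, TangentSpace (𝓡 n).tangent q) := by
  filter_upwards [eventually_mem_slit_inter he hp hpe] with q hq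
  rw [projV_eq hF he hq.1 hq.2, vertPart_frameH he hq.2]
  exact map_zero _

lemma projH_frameH (hF : IsFinsler F) (he : e ∈ IsManifold.maximalAtlas (𝓡 n) ∞ N)
    (hp : p ∈ slit n N) (hpe : p.1 ∈ e.source) (a : Fin n) :
    projH F (frameH F e a) =ᶠ[nhds p] frameH F e a := by
  filter_upwards [eventually_mem_slit_inter he hp hpe] with q hq
  apply dcoord_injective he hq.2
  rw [projH_eq hF he hq.1 hq.2, dcoord_symm_apply, dcoord_frameH_eq he hq.2]

/-- `G(v, ∂/∂y^d)` depends only on the vertical part of `v`. -/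
lemma sasaki_frameV (hF : IsFinsler F) (he : e ∈ IsManifold.maximalAtlas (𝓡 n) ∞ N)
    (hp : p ∈ slit n N) (hpe : p.1 ∈ e.source) (v : TangentSpace (𝓡 n).tangent p) (d : Fin n) :
    sasaki F p v (frameV e d p) = ∑ a, gMat F e (coord e p) a d * vertPart F e p v a := by
  rw [sasaki_eq hF he hp hpe, vertPart_frameV he hpe, dcoord_frameV he hpe]
  simp [ey]

/-- `G(v, δ/δx^d)` depends only on the horizontal part of `v`. -/
lemma sasaki_frameH (hF : IsFinsler F) (he : e ∈ IsManifold.maximalAtlas (𝓡 n) ∞ N)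
    (hp : p ∈ slit n N) (hpe : p.1 ∈ e.source) (v : TangentSpace (𝓡 n).tangent p) (d : Fin n) :
    sasaki F p v (frameH F e d p) = ∑ a, gMat F e (coord e p) a d * (dcoord e p v).1 a := by
  rw [sasaki_eq hF he hp hpe, vertPart_frameH he hpe, dcoord_frameH_eq he hpe]
  simp

lemma sasaki_frameV_frameV (hF : IsFinsler F) (he : e ∈ IsManifold.maximalAtlas (𝓡 n) ∞ N)
    (hp : p ∈ slit n N) (hpe : p.1 ∈ e.source) (a b : Fin n) :
    sasaki F p (frameV e a p) (frameV e b p) = gMat F e (coord e p) a b := by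
  rw [sasaki_frameV hF he hp hpe, vertPart_frameV he hpe]
  simp

lemma sasaki_frameH_frameH (hF : IsFinsler F) (he : e ∈ IsManifold.maximalAtlas (𝓡 n) ∞ N)
    (hp : p ∈ slit n N) (hpe : p.1 ∈ e.source) (a b : Fin n) :
    sasaki F p (frameH F e a p) (frameH F e b p) = gMat F e (coord e p) a b := by
  rw [sasaki_frameH hF he hp hpe, dcoord_frameH_eq he hpe]
  simp

lemma differentiableAt_gMat (hF : IsFinsler F) (he : e ∈ IsManifold.maximalAtlas (𝓡 n) ∞ N)
    {z : Mod n × Mod n} (hz : z ∈ slitDom e) (a b : Fin n) :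
    DifferentiableAt ℝ (fun u ↦ gMat F e u a b) z :=
  ((contDiffOn_gMat hF he a b).contDiffAt (isOpen_slitDom.mem_nhds hz)).differentiableAt (by simp)

lemma dirDeriv_sasaki_frameV (hF : IsFinsler F) (he : e ∈ IsManifold.maximalAtlas (𝓡 n) ∞ N)
    (hp : p ∈ slit n N) (hpe : p.1 ∈ e.source) (a b d : Fin n) :
    dirDeriv (fun q ↦ sasaki F q (frameV e a q) (frameV e b q)) p (frameV e d p) =
      dy d (fun u ↦ gMat F e u a b) (coord e p) := by
  rw [dirDeriv_eq he hpe (h := fun u ↦ gMat F e u a b)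
    ((eventually_mem_slit_inter he hp hpe).mono fun q hq ↦
      sasaki_frameV_frameV hF he hq.1 hq.2 a b)
    (differentiableAt_gMat hF he (coord_mem_slitDom he hp hpe) a b), dcoord_frameV he hpe]
  rfl

lemma dirDeriv_sasaki_frameH (hF : IsFinsler F) (he : e ∈ IsManifold.maximalAtlas (𝓡 n) ∞ N)
    (hp : p ∈ slit n N) (hpe : p.1 ∈ e.source) (a b d : Fin n) :
    dirDeriv (fun q ↦ sasaki F q (frameH F e a q) (frameH F e b q)) p (frameH F e d p) =
      deltaX F e d (fun u ↦ gMat F e u a b) (coord e p) := by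
  rw [dirDeriv_eq he hpe (h := fun u ↦ gMat F e u a b)
    ((eventually_mem_slit_inter he hp hpe).mono fun q hq ↦
      sasaki_frameH_frameH hF he hq.1 hq.2 a b)
    (differentiableAt_gMat hF he (coord_mem_slitDom he hp hpe) a b), dcoord_frameH he hpe,
    map_sub, map_sum]
  simp only [map_smul, smul_eq_mul]
  rfl

/-- The derivatives `∂g_{ab}/∂y^d` are symmetric in all indices. -/
lemma dy_gMat_symm (hF : IsFinsler F) (he : e ∈ IsManifold.maximalAtlas (𝓡 n) ∞ N)
    {z : Mod n × Mod n} (hz : z ∈ slitDom e) (a b d : Fin n) :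
    dy d (fun u ↦ gMat F e u a b) z = dy a (fun u ↦ gMat F e u d b) z := by
  have h0 := contDiffOn_dy isOpen_slitDom (contDiffOn_FSq hF he) b
  have h1 : ContDiffAt ℝ 2 (dy b (FSq F e)) z :=
    (h0.contDiffAt (isOpen_slitDom.mem_nhds hz)).of_le (by norm_cast)
  have h2 : ∀ c d, dy d (fun u ↦ gMat F e u c b) z =
      1 / 2 * fderiv ℝ (fderiv ℝ (dy b (FSq F e))) z (ey d) (ey c) := fun c d ↦ by
    rw [← fderiv_fderiv_apply h1]
    have h3 : DifferentiableAt ℝ (dy c (dy b (FSq F e))) z :=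
      ((contDiffOn_dy isOpen_slitDom h0 c).contDiffAt
        (isOpen_slitDom.mem_nhds hz)).differentiableAt (by simp)
    change fderiv ℝ (fun u ↦ 1 / 2 * dy c (dy b (FSq F e)) u) z (ey d) = _
    rw [fderiv_const_mul h3]
    rfl
  rw [h2, h2, isSymm_of_contDiffAt h1]

lemma dy_gMat_swap (hF : IsFinsler F) (he : e ∈ IsManifold.maximalAtlas (𝓡 n) ∞ N)
    {z : Mod n × Mod n} (hz : z ∈ slitDom e) (a b d : Fin n) :
    dy d (fun u ↦ gMat F e u a b) z = dy d (fun u ↦ gMat F e u b a) z := by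
  have h : (fun u ↦ gMat F e u a b) =ᶠ[nhds z] fun u ↦ gMat F e u b a := by
    filter_upwards [isOpen_slitDom.mem_nhds hz] with u hu using gMat_symm hF he hu a b
  rw [dy, dy, h.fderiv_eq]

/-- Recovering components from their contraction with `g`. -/
lemma eq_sum_inv_mul (hF : IsFinsler F) (he : e ∈ IsManifold.maximalAtlas (𝓡 n) ∞ N)
    {z : Mod n × Mod n} (hz : z ∈ slitDom e) {x κ : Fin n → ℝ}
    (h : ∀ d, ∑ a, gMat F e z a d * x a = κ d) (c : Fin n) :
    x c = ∑ d, (gMat F e z)⁻¹ c d * κ d := by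
  have h1 : κ = gMat F e z *ᵥ x := by
    funext d
    rw [← h d]
    exact Finset.sum_congr rfl fun a _ ↦ by rw [gMat_symm hF he hz]
  change x c = ((gMat F e z)⁻¹ *ᵥ κ) c
  rw [h1, Matrix.mulVec_mulVec,
    Matrix.nonsing_inv_mul _ (gMat_posDef hF he hz).det_pos.ne'.isUnit, Matrix.one_mulVec]

lemma sum_inv_mul_gMat (hF : IsFinsler F) (he : e ∈ IsManifold.maximalAtlas (𝓡 n) ∞ N)
    {z : Mod n × Mod n} (hz : z ∈ slitDom e) (c a : Fin n) :
    ∑ d, (gMat F e z)⁻¹ c d * gMat F e z d a = kron c a := by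
  have h := congrFun (congrFun (Matrix.nonsing_inv_mul (gMat F e z)
    (gMat_posDef hF he hz).det_pos.ne'.isUnit) c) a
  rwa [Matrix.mul_apply, Matrix.one_apply] at h

/-- The part of the coefficients that comes from `W`, raised with `g`. -/
lemma sum_inv_mul_weyl (hF : IsFinsler F) (he : e ∈ IsManifold.maximalAtlas (𝓡 n) ∞ N)
    {z : Mod n × Mod n} (hz : z ∈ slitDom e) (θ : Fin n → ℝ) (a b c : Fin n) :
    ∑ d, (gMat F e z)⁻¹ c d *
      (θ b * gMat F e z a d + θ a * gMat F e z d b - θ d * gMat F e z b a) =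
      θ a * kron c b + θ b * kron c a - (∑ d, (gMat F e z)⁻¹ c d * θ d) * gMat F e z a b := by
  rw [← sum_inv_mul_gMat hF he hz, ← sum_inv_mul_gMat hF he hz, Finset.mul_sum, Finset.mul_sum,
    Finset.sum_mul, ← Finset.sum_add_distrib, ← Finset.sum_sub_distrib]
  refine Finset.sum_congr rfl fun d _ ↦ ?_
  rw [gMat_symm hF he hz a d, gMat_symm hF he hz b a]
  ring

end Vranceanu

/-! ### The coefficients of the Vranceanu connection -/

section Coefficients

variable {n : ℕ} {N : Type*} [TopologicalSpace N] [ChartedSpace (Mod n) N]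
  [IsManifold (𝓡 n) ∞ N] {F : TangentBundle (𝓡 n) N → ℝ}
  {e : OpenPartialHomeomorph N (Mod n)} {p : TangentBundle (𝓡 n) N}
  {W : ∀ p : TangentBundle (𝓡 n) N, TangentSpace (𝓡 n).tangent p →L[ℝ] ℝ}
  {D : (∀ p : TangentBundle (𝓡 n) N, TangentSpace (𝓡 n).tangent p) →
      ∀ p : TangentBundle (𝓡 n) N,
        TangentSpace (𝓡 n).tangent p →L[ℝ] TangentSpace (𝓡 n).tangent p}

/-- The Vranceanu connection in terms of the germs at `p` of the vertical and horizontal parts of the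
two fields. -/
lemma vranceanu_eq (hF : IsFinsler F) (hD : IsWeylConnection F W D)
    (he : e ∈ IsManifold.maximalAtlas (𝓡 n) ∞ N) (hp : p ∈ slit n N) (hpe : p.1 ∈ e.source)
    {X Y X₁ X₂ Y₁ Y₂ : ∀ p : TangentBundle (𝓡 n) N, TangentSpace (𝓡 n).tangent p}
    (hX₁ : projV F X =ᶠ[nhds p] X₁) (hX₂ : projH F X =ᶠ[nhds p] X₂)
    (hY₁ : projV F Y =ᶠ[nhds p] Y₁) (hY₂ : projH F Y =ᶠ[nhds p] Y₂)
    (hdY₁ : MDiffAt (T% Y₁) p) (hdY₂ : MDiffAt (T% Y₂) p) :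
    vranceanu F D X Y p =
      ∑ c, vertPart F e p (D Y₁ p (X₁ p)) c • frameV e c p
      + ∑ c, (dcoord e p (D Y₂ p (X₂ p))).1 c • frameH F e c p
      + ∑ c, vertPart F e p (VectorField.mlieBracket (𝓡 n).tangent X₂ Y₁ p) c • frameV e c p
      + ∑ c, (dcoord e p (VectorField.mlieBracket (𝓡 n).tangent X₁ Y₂ p)).1 c •
        frameH F e c p := by
  have h1 : D (projV F Y) p (projV F X p) = D Y₁ p (X₁ p) := by
    rw [hX₁.self_of_nhds, covariantDerivative_congr hD.isCovariantDerivativeOn hp hdY₁ hY₁.symm]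
  have h2 : D (projH F Y) p (projH F X p) = D Y₂ p (X₂ p) := by
    rw [hX₂.self_of_nhds, covariantDerivative_congr hD.isCovariantDerivativeOn hp hdY₂ hY₂.symm]
  simp only [sum_smul_frameV he hpe, sum_smul_frameH he hpe]
  rw [vranceanu, projV_eq hF he hp hpe fun q ↦ D (projV F Y) q (projV F X q),
    projV_eq hF he hp hpe (VectorField.mlieBracket (𝓡 n).tangent (projH F X) (projV F Y)),
    projH_eq hF he hp hpe fun q ↦ D (projH F Y) q (projH F X q),
    projH_eq hF he hp hpe (VectorField.mlieBracket (𝓡 n).tangent (projV F X) (projH F Y)),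
    hX₂.mlieBracket_vectorField_eq hY₁, hX₁.mlieBracket_vectorField_eq hY₂, h1, h2]

lemma mdifferentiableAt_zero_field :
    MDiffAt (T% (0 : ∀ p : TangentBundle (𝓡 n) N, TangentSpace (𝓡 n).tangent p)) p :=
  Bundle.mdifferentiable_zeroSection ℝ _ p

lemma dcoord_zero : dcoord e p 0 = 0 := map_zero _

lemma vertPart_zero : vertPart F e p 0 = 0 := by
  rw [vertPart_eq, dcoord_zero]
  exact (zero_add _).trans (nonlinVec_zero _)

lemma covariantDerivative_zero (hD : IsWeylConnection F W D) (hp : p ∈ slit n N) :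
    D 0 p = 0 := by
  have h := hD.isCovariantDerivativeOn.leibniz (mdifferentiableAt_zero_field (p := p))
    (mdifferentiableAt_const (c := (0 : ℝ))) hp
  rw [smul_zero] at h
  rw [h]
  ext v
  simp

lemma sum_vertPart_smul_eq_zero {v : TangentSpace (𝓡 n).tangent p} (hv : v = 0) :
    ∑ c, vertPart F e p v c • frameV e c p = 0 := by
  subst hv
  rw [vertPart_zero]
  exact Finset.sum_eq_zero fun c _ ↦ zero_smul ℝ _

lemma sum_dcoord_smul_eq_zero {v : TangentSpace (𝓡 n).tangent p} (hv : (dcoord e p v).1 = 0) :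
    ∑ c, (dcoord e p v).1 c • frameH F e c p = 0 := by
  rw [hv]
  exact Finset.sum_eq_zero fun c _ ↦ zero_smul ℝ _

lemma dcoord_fst_eq_zero {v : TangentSpace (𝓡 n).tangent p} (hv : v = 0) :
    (dcoord e p v).1 = 0 := by
  rw [hv, dcoord_zero]
  rfl

lemma covariantDerivative_zero_apply (hD : IsWeylConnection F W D) (hp : p ∈ slit n N)
    (v : TangentSpace (𝓡 n).tangent p) : D 0 p v = 0 := by
  rw [covariantDerivative_zero hD hp]
  rfl

lemma covariantDerivative_apply_zero
    (Y : ∀ p : TangentBundle (𝓡 n) N, TangentSpace (𝓡 n).tangent p) :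
    D Y p ((0 : ∀ q : TangentBundle (𝓡 n) N, TangentSpace (𝓡 n).tangent q) p) = 0 :=
  map_zero _

lemma mlieBracket_zero_left_apply
    (X : ∀ p : TangentBundle (𝓡 n) N, TangentSpace (𝓡 n).tangent p) :
    VectorField.mlieBracket (𝓡 n).tangent 0 X p = 0 :=
  congrFun VectorField.mlieBracket_zero_left p

lemma mlieBracket_zero_right_apply
    (X : ∀ p : TangentBundle (𝓡 n) N, TangentSpace (𝓡 n).tangent p) :
    VectorField.mlieBracket (𝓡 n).tangent X 0 p = 0 :=
  congrFun VectorField.mlieBracket_zero_right p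

lemma vranceanu_frameV_frameV (hF : IsFinsler F) (hD : IsWeylConnection F W D)
    (he : e ∈ IsManifold.maximalAtlas (𝓡 n) ∞ N)
    (hp : p ∈ slit n N) (hpe : p.1 ∈ e.source) (a b : Fin n) :
    vranceanu F D (frameV e b) (frameV e a) p =
      ∑ c, vertPart F e p (D (frameV e a) p (frameV e b p)) c • frameV e c p := by
  rw [vranceanu_eq hF hD he hp hpe (projV_frameV hF he hp hpe b) (projH_frameV hF he hp hpe b)
    (projV_frameV hF he hp hpe a) (projH_frameV hF he hp hpe a)
    (mdifferentiableAt_frameV he hpe a) mdifferentiableAt_zero_field,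
    sum_dcoord_smul_eq_zero (dcoord_fst_eq_zero (covariantDerivative_apply_zero _)),
    sum_vertPart_smul_eq_zero (mlieBracket_zero_left_apply _),
    sum_dcoord_smul_eq_zero (dcoord_fst_eq_zero (mlieBracket_zero_right_apply _)),
    add_zero, add_zero, add_zero]

lemma vranceanu_frameH_frameV (hF : IsFinsler F) (hD : IsWeylConnection F W D)
    (he : e ∈ IsManifold.maximalAtlas (𝓡 n) ∞ N)
    (hp : p ∈ slit n N) (hpe : p.1 ∈ e.source) (a b : Fin n) :
    vranceanu F D (frameH F e b) (frameV e a) p =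
      ∑ c, dy a (nonlin F e c b) (coord e p) • frameV e c p := by
  rw [vranceanu_eq hF hD he hp hpe (projV_frameH hF he hp hpe b) (projH_frameH hF he hp hpe b)
    (projV_frameV hF he hp hpe a) (projH_frameV hF he hp hpe a)
    (mdifferentiableAt_frameV he hpe a) mdifferentiableAt_zero_field,
    sum_vertPart_smul_eq_zero (covariantDerivative_apply_zero _),
    sum_dcoord_smul_eq_zero (dcoord_fst_eq_zero (covariantDerivative_zero_apply hD hp _)),
    sum_dcoord_smul_eq_zero (dcoord_fst_eq_zero (mlieBracket_zero_left_apply _)),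
    vertPart_eq, dcoord_mlieBracket_frameH_frameV hF he hp hpe,
    show ∑ c, dy a (nonlin F e c b) (coord e p) • ey c =
      ((0, WithLp.toLp 2 fun c ↦ dy a (nonlin F e c b) (coord e p)) : Mod n × Mod n) from
        sum_smul_ey (WithLp.toLp 2 fun c ↦ dy a (nonlin F e c b) (coord e p)),
    nonlinVec_zero, add_zero, add_zero, add_zero, zero_add]

lemma vranceanu_frameV_frameH (hF : IsFinsler F) (hD : IsWeylConnection F W D)
    (he : e ∈ IsManifold.maximalAtlas (𝓡 n) ∞ N)
    (hp : p ∈ slit n N) (hpe : p.1 ∈ e.source) (a b : Fin n) :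
    vranceanu F D (frameV e b) (frameH F e a) p =
      0 := by
  rw [vranceanu_eq hF hD he hp hpe (projV_frameV hF he hp hpe b) (projH_frameV hF he hp hpe b)
    (projV_frameH hF he hp hpe a) (projH_frameH hF he hp hpe a)
    mdifferentiableAt_zero_field (mdifferentiableAt_frameH hF he hp hpe a),
    sum_vertPart_smul_eq_zero (covariantDerivative_zero_apply hD hp _),
    sum_dcoord_smul_eq_zero (dcoord_fst_eq_zero (covariantDerivative_apply_zero _)),
    sum_vertPart_smul_eq_zero (mlieBracket_zero_left_apply _),
    sum_dcoord_smul_eq_zero (dcoord_mlieBracket_frameV_frameH_fst hF he hp hpe a b),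
    add_zero, add_zero, add_zero]

lemma vranceanu_frameH_frameH (hF : IsFinsler F) (hD : IsWeylConnection F W D)
    (he : e ∈ IsManifold.maximalAtlas (𝓡 n) ∞ N)
    (hp : p ∈ slit n N) (hpe : p.1 ∈ e.source) (a b : Fin n) :
    vranceanu F D (frameH F e b) (frameH F e a) p =
      ∑ c, (dcoord e p (D (frameH F e a) p (frameH F e b p))).1 c • frameH F e c p := by
  rw [vranceanu_eq hF hD he hp hpe (projV_frameH hF he hp hpe b) (projH_frameH hF he hp hpe b)
    (projV_frameH hF he hp hpe a) (projH_frameH hF he hp hpe a)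
    mdifferentiableAt_zero_field (mdifferentiableAt_frameH hF he hp hpe a),
    sum_vertPart_smul_eq_zero (covariantDerivative_apply_zero _),
    sum_vertPart_smul_eq_zero (mlieBracket_zero_right_apply _),
    sum_dcoord_smul_eq_zero (dcoord_fst_eq_zero (mlieBracket_zero_left_apply _)),
    add_zero, add_zero, zero_add]

/-- The vertical coefficients of a Weyl connection along vertical fields. -/
lemma vertPart_covariantDerivative (hF : IsFinsler F) (hD : IsWeylConnection F W D)
    (he : e ∈ IsManifold.maximalAtlas (𝓡 n) ∞ N)
    (hp : p ∈ slit n N) (hpe : p.1 ∈ e.source) (a b c : Fin n) :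
    vertPart F e p (D (frameV e a) p (frameV e b p)) c = 1 / 2 *
      ((∑ d, (gMat F e (coord e p))⁻¹ c d * dy d (fun u ↦ gMat F e u a b) (coord e p))
        + W p (frameV e a p) * kron c b + W p (frameV e b p) * kron c a
        - (∑ d, (gMat F e (coord e p))⁻¹ c d * W p (frameV e d p)) *
          gMat F e (coord e p) a b) := by
  have hz := coord_mem_slitDom he hp hpe
  have hbr : ∀ a b d, sasaki F p (VectorField.mlieBracket (𝓡 n).tangent
      (frameV e a) (frameV e b) p) (frameV e d p) = 0 := fun a b d ↦ by
    rw [mlieBracket_frameV_frameV he hpe, sasaki_frameV hF he hp hpe, vertPart_zero]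
    simp
  have hdiff := mdifferentiableAt_frameV (p := p) he hpe
  have h1 : ∀ d, ∑ a', gMat F e (coord e p) a' d *
      vertPart F e p (D (frameV e a) p (frameV e b p)) a' = 1 / 2 *
        (dy d (fun u ↦ gMat F e u a b) (coord e p) +
          (W p (frameV e b p) * gMat F e (coord e p) a d +
            W p (frameV e a p) * gMat F e (coord e p) d b -
            W p (frameV e d p) * gMat F e (coord e p) b a)) := fun d ↦ by
    rw [← sasaki_frameV hF he hp hpe, hD.koszul hF hp (hdiff b) (hdiff a) (hdiff d) (hbr _ _ _)
      (hbr _ _ _) (hbr _ _ _)]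
    simp only [dirDeriv_sasaki_frameV hF he hp hpe, sasaki_frameV_frameV hF he hp hpe]
    -- The three derivatives of `g` coincide.
    have k1 := dy_gMat_swap hF he hz b a d
    have k2 := dy_gMat_symm hF he hz a b d
    rw [dy_gMat_swap hF he hz a d b, dy_gMat_symm hF he hz d a b, ← k2, k1]
    ring
  rw [eq_sum_inv_mul hF he hz h1, ← sub_eq_zero]
  have h2 := sum_inv_mul_weyl hF he hz (fun d ↦ W p (frameV e d p)) a b c
  simp only [mul_add, mul_left_comm _ (1 / 2 : ℝ), Finset.sum_add_distrib, ← Finset.mul_sum] at h2 ⊢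
  linarith

/-- The horizontal coefficients of a Weyl connection along horizontal fields. -/
lemma dcoord_covariantDerivative_fst (hF : IsFinsler F) (hD : IsWeylConnection F W D)
    (he : e ∈ IsManifold.maximalAtlas (𝓡 n) ∞ N)
    (hp : p ∈ slit n N) (hpe : p.1 ∈ e.source) (a b c : Fin n) :
    (dcoord e p (D (frameH F e a) p (frameH F e b p))).1 c =
      1 / 2 * (∑ d, (gMat F e (coord e p))⁻¹ c d *
        (deltaX F e a (fun u ↦ gMat F e u d b) (coord e p)
          + deltaX F e b (fun u ↦ gMat F e u a d) (coord e p)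
          - deltaX F e d (fun u ↦ gMat F e u a b) (coord e p)))
        + 1 / 2 * (W p (frameH F e a p) * kron c b + W p (frameH F e b p) * kron c a
          - (∑ d, (gMat F e (coord e p))⁻¹ c d * W p (frameH F e d p)) *
            gMat F e (coord e p) a b) := by
  have hz := coord_mem_slitDom he hp hpe
  have hbr : ∀ a b d, sasaki F p (VectorField.mlieBracket (𝓡 n).tangent
      (frameH F e a) (frameH F e b) p) (frameH F e d p) = 0 := fun a b d ↦ by
    rw [sasaki_frameH hF he hp hpe, dcoord_mlieBracket_frameH_frameH_fst hF he hp hpe]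
    simp
  have hdiff := mdifferentiableAt_frameH hF he hp hpe
  have hswap : ∀ d, deltaX F e d (fun u ↦ gMat F e u b a) (coord e p) =
      deltaX F e d (fun u ↦ gMat F e u a b) (coord e p) := fun d ↦ by
    rw [← dirDeriv_sasaki_frameH hF he hp hpe, ← dirDeriv_sasaki_frameH hF he hp hpe,
      dirDeriv_eq he hpe (h := fun u ↦ gMat F e u a b)
        ((eventually_mem_slit_inter he hp hpe).mono fun q hq ↦ ?_)
        (differentiableAt_gMat hF he hz a b), dirDeriv_eq he hpe (h := fun u ↦ gMat F e u a b)
        ((eventually_mem_slit_inter he hp hpe).mono fun q hq ↦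
          sasaki_frameH_frameH hF he hq.1 hq.2 a b) (differentiableAt_gMat hF he hz a b)]
    simp only [sasaki_symm hF hq.1 (frameH F e b q)]
    exact sasaki_frameH_frameH hF he hq.1 hq.2 a b
  have h1 : ∀ d, ∑ a', gMat F e (coord e p) a' d *
      (dcoord e p (D (frameH F e a) p (frameH F e b p))).1 a' = 1 / 2 *
        ((deltaX F e a (fun u ↦ gMat F e u d b) (coord e p)
          + deltaX F e b (fun u ↦ gMat F e u a d) (coord e p)
          - deltaX F e d (fun u ↦ gMat F e u a b) (coord e p)) +
          (W p (frameH F e b p) * gMat F e (coord e p) a d +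
            W p (frameH F e a p) * gMat F e (coord e p) d b -
            W p (frameH F e d p) * gMat F e (coord e p) b a)) := fun d ↦ by
    rw [← sasaki_frameH hF he hp hpe, hD.koszul hF hp (hdiff b) (hdiff a) (hdiff d) (hbr _ _ _)
      (hbr _ _ _) (hbr _ _ _)]
    simp only [dirDeriv_sasaki_frameH hF he hp hpe, sasaki_frameH_frameH hF he hp hpe, hswap]
    ring
  rw [eq_sum_inv_mul hF he hz h1, ← sub_eq_zero]
  have h2 := sum_inv_mul_weyl hF he hz (fun d ↦ W p (frameH F e d p)) a b c
  simp only [mul_left_comm _ (1 / 2 : ℝ), ← Finset.mul_sum]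
  rw [← h2, sub_eq_zero, ← mul_add, ← Finset.sum_add_distrib]
  simp only [mul_add]

lemma linearIndependent_frame (he : e ∈ IsManifold.maximalAtlas (𝓡 n) ∞ N)
    (hpe : p.1 ∈ e.source) :
    LinearIndependent ℝ (Sum.elim (fun a ↦ frameV e a p) (fun a ↦ frameH F e a p)) := by
  rw [Fintype.linearIndependent_iff]
  intro t ht
  rw [Fintype.sum_sum_type] at ht
  simp only [Sum.elim_inl, Sum.elim_inr] at ht
  have h1 := sum_smul_frameV he hpe (WithLp.toLp 2 fun a ↦ t (.inl a))
  have h2 := sum_smul_frameH (F := F) he hpe (WithLp.toLp 2 fun a ↦ t (.inr a))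
  simp only at h1 h2
  rw [h1, h2, ← map_add] at ht
  have h3 := (map_eq_zero_iff _ (coordEquiv he hpe).symm.injective).1 ht
  have h4 : (WithLp.toLp 2 fun a ↦ t (.inr a) : Mod n) = 0 := by
    have := congrArg Prod.fst h3
    simpa using this
  have h5 : (WithLp.toLp 2 fun a ↦ t (.inl a) : Mod n) = 0 := by
    have := congrArg Prod.snd h3
    rw [h4, nonlinVec_zero] at this
    simpa using this
  rintro (a | a)
  · exact congrFun (congrArg WithLp.ofLp h5) a
  · exact congrFun (congrArg WithLp.ofLp h4) a

end Coefficients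

end FinslerWeyl

end

theorem proposition3p2 {n : ℕ} {N : Type*} [TopologicalSpace N]
    [ChartedSpace (FinslerWeyl.Mod n) N] [IsManifold (𝓡 n) ∞ N]
    (F : TangentBundle (𝓡 n) N → ℝ) (hF : FinslerWeyl.IsFinsler F)
    (W : ∀ p : TangentBundle (𝓡 n) N, TangentSpace (𝓡 n).tangent p →L[ℝ] ℝ) :
    (∃ D, FinslerWeyl.IsWeylConnection F W D) ∧
    ∀ D, FinslerWeyl.IsWeylConnection F W D →
      ∀ e ∈ IsManifold.maximalAtlas (𝓡 n) ∞ N,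
      ∀ p ∈ FinslerWeyl.slit n N, p.1 ∈ e.source →
        let z := FinslerWeyl.coord e p
        let g := FinslerWeyl.gMat F e
        let gInv := (g z)⁻¹
        let V := FinslerWeyl.frameV e
        let H := FinslerWeyl.frameH F e
        -- the components in `W = ρ_a dx^a + θ_a δy^a`, and their raised versions
        let ρ := fun a ↦ W p (H a p)
        let θ := fun a ↦ W p (V a p)
        let ρup := fun c ↦ ∑ d, gInv c d * ρ d
        let θup := fun c ↦ ∑ d, gInv c d * θ d
        let C := fun c a b : Fin n ↦ 1 / 2 *
          ((∑ d, gInv c d * FinslerWeyl.dy d (fun u ↦ g u a b) z)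
            + θ a * FinslerWeyl.kron c b + θ b * FinslerWeyl.kron c a - θup c * g z a b)
        let DD := fun c a b : Fin n ↦
          FinslerWeyl.dy a (FinslerWeyl.dy b (FinslerWeyl.spray F e c)) z
        let K := fun c a b : Fin n ↦
          1 / 2 * (∑ d, gInv c d *
            (FinslerWeyl.deltaX F e a (fun u ↦ g u d b) z
              + FinslerWeyl.deltaX F e b (fun u ↦ g u a d) z
              - FinslerWeyl.deltaX F e d (fun u ↦ g u a b) z))
          + 1 / 2 * (ρ a * FinslerWeyl.kron c b + ρ b * FinslerWeyl.kron c a - ρup c * g z a b)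
        let L := fun _ _ _ : Fin n ↦ (0 : ℝ)
        -- `V`, `H` is a frame, so that the coefficients below are determined by the connection
        LinearIndependent ℝ (Sum.elim (fun a ↦ V a p) (fun a ↦ H a p)) ∧
        ∀ a b : Fin n,
          FinslerWeyl.vranceanu F D (V b) (V a) p = ∑ c, C c a b • V c p ∧
          FinslerWeyl.vranceanu F D (H b) (V a) p = ∑ c, DD c a b • V c p ∧
          FinslerWeyl.vranceanu F D (V b) (H a) p = ∑ c, L c a b • H c p ∧
          FinslerWeyl.vranceanu F D (H b) (H a) p = ∑ c, K c a b • H c p := by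
  open FinslerWeyl in
  refine ⟨⟨_, isWeylConnection_weylConnection hF⟩, fun D hD e he p hp hpe ↦
    ⟨linearIndependent_frame he hpe, fun a b ↦ ⟨?_, ?_, ?_, ?_⟩⟩⟩
  · rw [vranceanu_frameV_frameV hF hD he hp hpe]
    simp only [vertPart_covariantDerivative hF hD he hp hpe]
  · exact vranceanu_frameH_frameV hF hD he hp hpe a b
  · rw [vranceanu_frameV_frameH hF hD he hp hpe]
    exact (Finset.sum_eq_zero fun c _ ↦ zero_smul ℝ _).symm
  · rw [vranceanu_frameH_frameH hF hD he hp hpe]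
    simp only [dcoord_covariantDerivative_fst hF hD he hp hpe]
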